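/- Let $\mathbf{H}^3$ be hyperbolic 3-space of curvature $-1$. For $v>0$ let $A(v)$ be the area of a round (geodesic) sphere enclosing volume $v$. A standard double bubble in $\mathbf{H}^3$ consists of three caps with a common boundary circle, meeting along it at $120^\circ$: two outer caps lying on geodesic spheres, and a separating cap lying on a sphere, horosphere, hypersphere or geodesic plane. It encloses two regions, each bounded by one outer cap and the separating cap. For $v,w>0$ let $A(v,w)$ be the total area of the three caps of the standard double bubble (unique up to isometry) whose regions have volumes $v$ and $w$. The Hutchings function is $$F(v,w)=2A\left(\tfrac v2\right)+A(w)+A(v+w)-2A(v,w).$$ Let $\lambda=\frac{e^2}{4}-1$. Then for every real $w\ge 300$ the four areas entering $F(\lambda w,w)$ are well defined, the function $t\mapsto F(\lambda t,t)$ is differentiable at $t=w$, and $$\left.\frac{d}{dt}F(\lambda t,t)\right|_{t=w}<0 .$$ -/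

import Mathlib

open MeasureTheory

noncomputable section

namespace HypBubble

/-! Hyperbolic 3-space is the Poincaré ball model: the open unit ball of `ℝ³`, here `ℝ × ℝ × ℝ`
with points `(x, y, z)`, carrying the metric `4 |dp|² / (1 - |p|²)²` of curvature `-1`. -/

/-- The square of the Euclidean norm of a point of `ℝ³`. -/
def normSq (p : ℝ × ℝ × ℝ) : ℝ := p.1 ^ 2 + p.2.1 ^ 2 + p.2.2 ^ 2

/-- The point set of the Poincaré ball model. -/
def hypSpace : Set (ℝ × ℝ × ℝ) := {p | normSq p < 1}

/-- Hyperbolic volume: density `(2 / (1 - |p|²))³` with respect to Lebesgue measure on the ball. -/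
def hypVolume : Measure (ℝ × ℝ × ℝ) :=
  (volume.restrict hypSpace).withDensity fun p => ENNReal.ofReal ((2 / (1 - normSq p)) ^ 3)

/-- Hyperbolic area of the surface obtained by rotating the curve `t ↦ (s t, 0, z t)`,
`a ≤ t ≤ b`, `0 ≤ s`, about the `z`-axis: the Euclidean area element `2π s |(s', z')| dt`, times
the conformal factor `(2 / (1 - s² - z²))²`. -/
def hypRevolutionArea (s z : ℝ → ℝ) (a b : ℝ) : ℝ :=
  ∫ t in a..b, 2 * Real.pi * s t * √(deriv s t ^ 2 + deriv z t ^ 2) *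
    (2 / (1 - s t ^ 2 - z t ^ 2)) ^ 2

/-! ### Single bubbles -/

/-- The open Euclidean ball of radius `R < 1` about the origin: up to isometry, the geodesic ball
of hyperbolic radius `2 artanh R`. -/
def roundBall (R : ℝ) : Set (ℝ × ℝ × ℝ) := {p | normSq p < R ^ 2}

/-- The hyperbolic area of the boundary sphere of `roundBall R`. -/
def roundSphereArea (R : ℝ) : ℝ :=
  hypRevolutionArea (fun t => R * Real.sin t) (fun t => R * Real.cos t) 0 Real.pi

/-- `a` is the area of a round sphere enclosing the volume `v`. -/
def IsSphereArea (v a : ℝ) : Prop :=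
  ∃ R : ℝ, 0 < R ∧ R < 1 ∧ hypVolume (roundBall R) = ENNReal.ofReal v ∧ a = roundSphereArea R

/-- `A(v)`, the area of the round sphere enclosing the volume `v`. -/
def sphereArea (v : ℝ) : ℝ := sInf {a | IsSphereArea v a}

/-! ### Standard double bubbles

Up to isometry, the common boundary circle of the three caps is the circle
`C = {x² + y² = ρ², z = 0}` with `0 < ρ < 1`. Hyperbolic spheres, horospheres, hyperspheres and
geodesic planes are the Euclidean spheres and planes of the model, and the angles of the model are
the Euclidean ones. The spheres and planes through `C` are the surfaces `pencil ρ β = 0`. -/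

/-- The defining function of the sphere (plane, if `sin β = 0`) through the circle `C` of
radius `ρ` that makes the angle `β` with the plane `z = 0` along `C`: at the point `(ρ, 0, 0)` its
gradient is `2ρ (sin β, 0, cos β)`. -/
def pencil (ρ β : ℝ) (p : ℝ × ℝ × ℝ) : ℝ :=
  Real.sin β * (normSq p - ρ ^ 2) + 2 * ρ * Real.cos β * p.2.2

/-- The area of the cap of `pencil ρ β = 0`, `-π < β < π`, that is bounded by `C` and makes the
angle `β` with the flat disc spanned by `C` (above it for `β > 0`, below it for `β < 0`, the disc
itself for `β = 0`). Put `τ = tan (β / 2)`. The generating curve is the circular arc, or segment,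
from the apex `(s, z) = (0, ρ τ)` at `t = 0` to `(s, z) = (ρ, 0)` at `t = 1`. -/
def capArea (ρ β : ℝ) : ℝ :=
  hypRevolutionArea
    (fun t => ρ * t * (1 + Real.tan (β / 2) ^ 2) / (1 + Real.tan (β / 2) ^ 2 * t ^ 2))
    (fun t => ρ * Real.tan (β / 2) * (1 - t ^ 2) / (1 + Real.tan (β / 2) ^ 2 * t ^ 2)) 0 1

/-- The parameters `ρ, θ` describe a standard double bubble: three caps with common boundary `C`
that make the angles `θ + 2π/3` (upper outer cap), `θ` (separating cap) and `θ - 2π/3` (lower outer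
cap) with the disc spanned by `C`, so that they meet at 120 degrees, where the outer caps lie on
spheres contained in hyperbolic space. -/
def IsStandardDoubleBubble (ρ θ : ℝ) : Prop :=
  0 < ρ ∧ -(Real.pi / 3) < θ ∧ θ < Real.pi / 3 ∧
    {p | pencil ρ (θ + 2 * Real.pi / 3) p = 0} ⊆ hypSpace ∧
    {p | pencil ρ (θ - 2 * Real.pi / 3) p = 0} ⊆ hypSpace

/-- The region enclosed by the upper outer cap and the separating cap: the part of the ball bounded
by the upper outer sphere that lies above the separating surface. -/
def upperRegion (ρ θ : ℝ) : Set (ℝ × ℝ × ℝ) :=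
  {p | pencil ρ (θ + 2 * Real.pi / 3) p < 0 ∧ 0 < pencil ρ θ p}

/-- The region enclosed by the lower outer cap and the separating cap: the part of the ball bounded
by the lower outer sphere that lies below the separating surface. -/
def lowerRegion (ρ θ : ℝ) : Set (ℝ × ℝ × ℝ) :=
  {p | 0 < pencil ρ (θ - 2 * Real.pi / 3) p ∧ pencil ρ θ p < 0}

/-- The total area of the three caps. -/
def doubleBubbleTotalArea (ρ θ : ℝ) : ℝ :=
  capArea ρ (θ + 2 * Real.pi / 3) + capArea ρ θ + capArea ρ (θ - 2 * Real.pi / 3)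

/-- `a` is the area of a standard double bubble enclosing and separating the volumes `v`, `w`. -/
def IsDoubleBubbleArea (v w a : ℝ) : Prop :=
  ∃ ρ θ : ℝ, IsStandardDoubleBubble ρ θ ∧ hypVolume (upperRegion ρ θ) = ENNReal.ofReal v ∧
    hypVolume (lowerRegion ρ θ) = ENNReal.ofReal w ∧ a = doubleBubbleTotalArea ρ θ

/-- `A(v, w)`, the area of the standard double bubble enclosing and separating the volumes
`v`, `w`. -/
def doubleBubbleArea (v w : ℝ) : ℝ := sInf {a | IsDoubleBubbleArea v w a}

/-! ### The Hutchings function -/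

/-- The Hutchings function `F(v, w) = 2 A(v/2) + A(w) + A(v + w) - 2 A(v, w)`. -/
def hutchings (v w : ℝ) : ℝ :=
  2 * sphereArea (v / 2) + sphereArea w + sphereArea (v + w) - 2 * doubleBubbleArea v w

/-- All the areas that occur in `F(v, w)` exist and are unique. -/
def HutchingsWellDefined (v w : ℝ) : Prop :=
  (∃! a, IsSphereArea (v / 2) a) ∧ (∃! a, IsSphereArea w a) ∧ (∃! a, IsSphereArea (v + w) a) ∧
    ∃! a, IsDoubleBubbleArea v w a

/-- The slope `λ = e²/4 - 1` of the critical line `v = λ w`. -/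
def criticalSlope : ℝ := Real.exp 2 / 4 - 1

end HypBubble

end

namespace HypBubble
open Set

/-! By first variation, the derivative of area with respect to volume is the pressure of the
bounding surface (twice its mean curvature). A geodesic sphere of radius `log y` has pressure `2 + 4
/ (y ^ 2 - 1)`. A double bubble with outer pressures `p.1`, `p.2` has `dA = p.1 dv + p.2 dw`. With
`c` the critical slope, `Eᵢ = zᵢ ^ 2 - 1` for the three spheres and `yᵢ = 4 / (pᵢ - 2)` for the
outer caps, the constant parts of the pressures cancel in the derivative along the ray, leaving `F'
/ 4 = c / E₁ + 1 / E₂ + (1 + c) / E₃ - 2 * c / y₁ - 2 / y₂`.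

Put `s = 2 w / π`. A ball of normalized volume `a` has `E ≥ a + 2 log a - 1`, whereas an outer cap
bounding normalized volume `b` has `y` at most about `b + 2 log (b / 2) + 2.15`. In powers of `1 /
s` the first-order terms cancel, `2 + 1 + 1 = 2 + 2`. At second order, the coefficient of `log s` in
the negative part minus the positive part is `4 / c + 2 / (1 + c) - 2 > 0`. Hence `F'` is eventually
negative. Explicit constants make this effective for `s ≥ 190.9`, which `w ≥ 300` guarantees. The
special value of `c` enters only through numerical bounds and `log (1 + c) = 2 - 2 log 2`.

The geometric work is to make the double bubble a differentiable function of its volumes. Bubbles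
are parametrized by their outer pressures, a pair in the convex set `pressureDomain`. At fixed angle
the volume under a cap decreases with its pressure; the effect of changing the angle is the same for
all caps and cancels in both chambers. The Jacobian of the volumes is therefore symmetric and
negative definite (`hasDerivAt_along_curve`). This yields uniqueness (`eq_of_volumes_eq`), existence
by minimizing a Legendre transform (`exists_bubble_of_box`), and, by the inverse function theorem,
the ray derivative (`hasDerivAt_doubleBubbleArea`). The estimates are in `upperVolume_bounds` and
`critical_inequality`. -/

/-! ### Hyperbolic volume by horizontal slices -/

lemma hasDerivAt_inv_sq {f : ℝ → ℝ} {f' x : ℝ} (hf : HasDerivAt f f' x) (h : f x ≠ 0) :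
    HasDerivAt (fun y => 1 / f y ^ 2) (-(2 * f') / f x ^ 3) x := by
  have := (hf.pow 2).inv (pow_ne_zero 2 h)
  simp only [one_div]
  refine this.congr_deriv ?_
  simp only [Pi.pow_apply]
  field_simp
  norm_num
  ring

/-- Radial integral of the hyperbolic density over a horizontal disc. -/
lemma lintegral_radial {c f : ℝ} (hf : 0 ≤ f) (hfc : f < c) :
    ∫⁻ r in Ioo 0 (√f), ENNReal.ofReal r * ENNReal.ofReal ((2 / (c - r ^ 2)) ^ 3) =
      ENNReal.ofReal (2 * (1 / (c - f) ^ 2 - 1 / c ^ 2)) := by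
  have hpos : ∀ r ∈ Icc 0 (√f), 0 < c - r ^ 2 := fun r hr => by
    have : r ^ 2 ≤ (√f) ^ 2 := pow_le_pow_left₀ hr.1 hr.2 2
    rw [Real.sq_sqrt hf] at this
    linarith
  have hcont : ContinuousOn (fun r : ℝ => r * (2 / (c - r ^ 2)) ^ 3) (Icc 0 (√f)) := by
    refine continuousOn_id.mul (ContinuousOn.pow (ContinuousOn.div continuousOn_const
      (by fun_prop) fun r hr => (hpos r hr).ne') 3)
  have hint : IntervalIntegrable (fun r : ℝ => r * (2 / (c - r ^ 2)) ^ 3) volume 0 (√f) :=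
    (by rwa [uIcc_of_le (Real.sqrt_nonneg f)] : ContinuousOn _ (uIcc 0 (√f))).intervalIntegrable
  have hFTC : ∫ r in (0 : ℝ)..√f, r * (2 / (c - r ^ 2)) ^ 3 =
      2 * (1 / (c - f) ^ 2 - 1 / c ^ 2) := by
    rw [intervalIntegral.integral_eq_sub_of_hasDerivAt
      (f := fun r => 2 * (1 / (c - r ^ 2) ^ 2)) _ hint]
    · rw [Real.sq_sqrt hf]; ring
    · intro r hr
      rw [uIcc_of_le (Real.sqrt_nonneg f)] at hr
      have h1 : HasDerivAt (fun r : ℝ => c - r ^ 2) (-(2 * r)) r := by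
        simpa using ((hasDerivAt_id r).pow 2).const_sub c
      refine ((hasDerivAt_inv_sq h1 (hpos r hr).ne').const_mul 2).congr_deriv ?_
      have := (hpos r hr).ne'
      field_simp
  rw [← hFTC, intervalIntegral.integral_of_le (Real.sqrt_nonneg f), integral_Ioc_eq_integral_Ioo,
    ofReal_integral_eq_lintegral_ofReal]
  · refine setLIntegral_congr_fun measurableSet_Ioo fun r hr => ?_
    rw [ENNReal.ofReal_mul hr.1.le]
  · exact (hcont.integrableOn_Icc).mono_set Ioo_subset_Icc_self
  · refine (ae_restrict_iff' measurableSet_Ioo).2 (Filter.Eventually.of_forall fun r hr => ?_)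
    have := (hpos r (Ioo_subset_Icc_self hr)).le
    have := hr.1.le
    simp only [Pi.zero_apply]
    positivity

/-- The hyperbolic density integrated over a horizontal disc, with or without parts of its
boundary circle. -/
lemma lintegral_disc {c f : ℝ} (hf : 0 ≤ f) (hfc : f < c) {A : Set (ℝ × ℝ)}
    (hA : MeasurableSet A) (h1 : ∀ q : ℝ × ℝ, q.1 ^ 2 + q.2 ^ 2 < f → q ∈ A)
    (h2 : ∀ q ∈ A, q.1 ^ 2 + q.2 ^ 2 ≤ f) :
    ∫⁻ q : ℝ × ℝ, A.indicator
      (fun q => ENNReal.ofReal ((2 / (c - (q.1 ^ 2 + q.2 ^ 2))) ^ 3)) q =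
      ENNReal.ofReal (4 * Real.pi * (1 / (c - f) ^ 2 - 1 / c ^ 2)) := by
  have hmeas : Measurable (A.indicator
      (fun q : ℝ × ℝ => ENNReal.ofReal ((2 / (c - (q.1 ^ 2 + q.2 ^ 2))) ^ 3))) := by
    refine Measurable.indicator ?_ hA
    fun_prop
  rw [← lintegral_comp_polarCoord_symm, polarCoord_target, Measure.volume_eq_prod,
    ← Measure.prod_restrict, lintegral_prod_symm]
  swap
  · refine Measurable.aemeasurable ?_
    simp only [smul_eq_mul]
    exact (by fun_prop : Measurable fun p : ℝ × ℝ => ENNReal.ofReal p.1).mul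
      (hmeas.comp continuous_polarCoord_symm.measurable)
  have key : ∀ φ : ℝ, ∫⁻ r in Ioi (0 : ℝ), ENNReal.ofReal r • A.indicator
      (fun q : ℝ × ℝ => ENNReal.ofReal ((2 / (c - (q.1 ^ 2 + q.2 ^ 2))) ^ 3))
        (polarCoord.symm (r, φ)) =
      ENNReal.ofReal (2 * (1 / (c - f) ^ 2 - 1 / c ^ 2)) := by
    intro φ
    rw [← lintegral_radial hf hfc, ← lintegral_indicator measurableSet_Ioi,
      ← lintegral_indicator measurableSet_Ioo]
    -- Membership in `A` is undetermined only on the circle `r = √f`, a null set of radii.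
    refine lintegral_congr_ae ?_
    filter_upwards [compl_mem_ae_iff.2 (measure_singleton (√f))] with r hr
    have hrr : (r * Real.cos φ) ^ 2 + (r * Real.sin φ) ^ 2 = r ^ 2 := by
      linear_combination r ^ 2 * Real.sin_sq_add_cos_sq φ
    by_cases h0 : 0 < r
    · rw [indicator_of_mem (mem_Ioi.2 h0)]
      rcases lt_trichotomy r (√f) with h | h | h
      · rw [indicator_of_mem (mem_Ioo.2 ⟨h0, h⟩), indicator_of_mem]
        · simp only [polarCoord_symm_apply, hrr, smul_eq_mul]
        · apply h1
          simp only [polarCoord_symm_apply, hrr]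
          exact (Real.lt_sqrt h0.le).1 h
      · exact absurd h hr
      · rw [indicator_of_notMem (fun hh : r ∈ Ioo 0 (√f) => (lt_asymm h hh.2)),
          indicator_of_notMem, smul_zero]
        intro hh
        have := h2 _ hh
        simp only [polarCoord_symm_apply, hrr] at this
        exact absurd (Real.le_sqrt' h0 |>.2 this) (not_le.2 h)
    · rw [indicator_of_notMem (by simpa using h0),
        indicator_of_notMem (fun hh : r ∈ Ioo 0 (√f) => h0 hh.1)]
  simp only [key, lintegral_const, Measure.restrict_apply MeasurableSet.univ, univ_inter,
    Real.volume_Ioo]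
  rw [← ENNReal.ofReal_mul']
  · ring_nf
  · linarith [Real.pi_pos]

/-- Hyperbolic volume of a set whose horizontal slices are discs. -/
theorem hypVolume_of_slices {a b : ℝ} (hab : a ≤ b) {f : ℝ → ℝ} {S : Set (ℝ × ℝ × ℝ)}
    (hS : MeasurableSet S) (hf : ∀ z ∈ Ioo a b, 0 ≤ f z)
    (hfc : ∀ z ∈ Icc a b, f z < 1 - z ^ 2) (hz : ∀ z ∈ Icc a b, z ^ 2 < 1)
    (hcont : ContinuousOn f (Icc a b))
    (h1 : ∀ x y z : ℝ, z ∈ Ioo a b → x ^ 2 + y ^ 2 < f z → (x, y, z) ∈ S)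
    (h2 : ∀ x y z : ℝ, (x, y, z) ∈ S → z ∈ Icc a b ∧ x ^ 2 + y ^ 2 ≤ f z) :
    hypVolume S = ENNReal.ofReal
      (∫ z in a..b, 4 * Real.pi * (1 / (1 - z ^ 2 - f z) ^ 2 - 1 / (1 - z ^ 2) ^ 2)) := by
  have hsub : S ⊆ hypSpace := by
    rintro ⟨x, y, z⟩ hp
    obtain ⟨hz1, hz2⟩ := h2 x y z hp
    have := hfc z hz1
    simp only [hypSpace, normSq, mem_ofPred_eq]
    linarith
  have hmd : Measurable (fun p : ℝ × ℝ × ℝ => ENNReal.ofReal ((2 / (1 - normSq p)) ^ 3)) := by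
    unfold normSq
    fun_prop
  have hmi := hmd.indicator hS
  -- Reassociating the product isolates `z`, so that Tonelli integrates over the horizontal discs
  -- first.
  rw [hypVolume, withDensity_apply _ hS, Measure.restrict_restrict hS,
    inter_eq_left.2 hsub, ← lintegral_indicator hS,
    ← volume_preserving_prodAssoc.lintegral_comp_emb MeasurableEquiv.prodAssoc.measurableEmbedding,
    Measure.volume_eq_prod, lintegral_prod_symm]
  swap
  · exact (hmi.comp MeasurableEquiv.prodAssoc.measurable).aemeasurable
  have hco : ContinuousOn
      (fun z => 4 * Real.pi * (1 / (1 - z ^ 2 - f z) ^ 2 - 1 / (1 - z ^ 2) ^ 2)) (Icc a b) := by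
    refine continuousOn_const.mul (ContinuousOn.sub ?_ ?_)
    · exact ContinuousOn.div continuousOn_const (by fun_prop)
        fun z hz => pow_ne_zero 2 (by linarith [hfc z hz])
    · exact ContinuousOn.div continuousOn_const (by fun_prop)
        fun z hz' => pow_ne_zero 2 (by linarith [hz z hz'])
  have hnn : ∀ z ∈ Ioo a b, 0 ≤ 4 * Real.pi * (1 / (1 - z ^ 2 - f z) ^ 2 - 1 / (1 - z ^ 2) ^ 2) := by
    intro z hz'
    refine mul_nonneg (by positivity) (sub_nonneg.2 ?_)
    have h3 := hfc z (Ioo_subset_Icc_self hz')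
    have h4 := hf z hz'
    exact one_div_le_one_div_of_le (pow_pos (by linarith) 2)
      (pow_le_pow_left₀ (by linarith) (by linarith) 2)
  rw [intervalIntegral.integral_of_le hab, integral_Ioc_eq_integral_Ioo,
    ofReal_integral_eq_lintegral_ofReal
      ((hco.integrableOn_Icc).mono_set Ioo_subset_Icc_self)
      ((ae_restrict_iff' measurableSet_Ioo).2 (Filter.Eventually.of_forall hnn)),
    ← lintegral_indicator measurableSet_Ioo]
  refine lintegral_congr_ae ?_
  filter_upwards [compl_mem_ae_iff.2 (measure_singleton a),
    compl_mem_ae_iff.2 (measure_singleton b)] with z hza hzb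
  by_cases hzI : z ∈ Ioo a b
  · rw [indicator_of_mem hzI]
    have hA : MeasurableSet {q : ℝ × ℝ | (q.1, q.2, z) ∈ S} := by
      refine hS.preimage ?_
      fun_prop
    rw [← lintegral_disc (hf z hzI) (hfc z (Ioo_subset_Icc_self hzI)) hA
      (fun q hq => h1 q.1 q.2 z hzI hq) (fun q hq => (h2 q.1 q.2 z hq).2)]
    refine lintegral_congr fun q => ?_
    simp only [indicator, mem_ofPred_eq, MeasurableEquiv.prodAssoc, MeasurableEquiv.coe_mk,
      Equiv.prodAssoc_apply, normSq]
    congr 4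
    ring
  · rw [indicator_of_notMem hzI, lintegral_eq_zero_of_ae_eq_zero]
    refine Filter.Eventually.of_forall fun q => indicator_of_notMem (fun hh => hzI ?_) _
    have := (h2 q.1 q.2 z hh).1
    exact ⟨lt_of_le_of_ne this.1 (Ne.symm hza), lt_of_le_of_ne this.2 hzb⟩

/-! ### Volumes of lenses, of the two chambers and of balls -/

/-- Signed hyperbolic volume between the flat disc of Euclidean radius `ρ` about the origin and
the spherical cap over its boundary with apex `(0, 0, u)`. -/
noncomputable def lensVolume (ρ u : ℝ) : ℝ :=
  2 * Real.pi * (u * (1 + ρ ^ 2) / ((1 - ρ ^ 2) * (1 - u ^ 2))) -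
    Real.pi * (Real.log (1 + u) - Real.log (1 - u))

/-- Signed hyperbolic volume between the flat disc and the cap that makes the angle `β` with it. -/
noncomputable def capVolume (ρ β : ℝ) : ℝ := lensVolume ρ (ρ * Real.tan (β / 2))

lemma lensVolume_neg (ρ u : ℝ) : lensVolume ρ (-u) = -lensVolume ρ u := by
  unfold lensVolume
  rw [neg_sq, sub_neg_eq_add, ← sub_eq_add_neg]
  ring

lemma capVolume_neg (ρ β : ℝ) : capVolume ρ (-β) = -capVolume ρ β := by
  rw [capVolume, capVolume, neg_div, Real.tan_neg, mul_neg, lensVolume_neg]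

lemma hasDerivAt_log_ratio {z : ℝ} (h1 : -1 < z) (h2 : z < 1) :
    HasDerivAt (fun z => Real.log (1 + z) - Real.log (1 - z)) (2 / (1 - z ^ 2)) z := by
  have h3 : 1 + z ≠ 0 := by linarith
  have h4 : 1 - z ≠ 0 := by linarith
  have h5 : 1 - z ^ 2 ≠ 0 := by
    have : 1 - z ^ 2 = (1 + z) * (1 - z) := by ring
    rw [this]; exact mul_ne_zero h3 h4
  refine ((((hasDerivAt_id z).const_add 1).log h3).sub
    (((hasDerivAt_id z).const_sub 1).log h4)).congr_deriv ?_
  simp only [id]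
  field_simp
  ring

lemma hasDerivAt_density_primitive {z : ℝ} (h1 : -1 < z) (h2 : z < 1) :
    HasDerivAt (fun z => z / (2 * (1 - z ^ 2)) + (Real.log (1 + z) - Real.log (1 - z)) / 4)
      (1 / (1 - z ^ 2) ^ 2) z := by
  have h5 : 1 - z ^ 2 ≠ 0 := by nlinarith
  have h6 : HasDerivAt (fun z : ℝ => 2 * (1 - z ^ 2)) (2 * -(2 * z)) z := by
    simpa using (((hasDerivAt_id z).pow 2).const_sub 1).const_mul 2
  refine (((hasDerivAt_id z).div h6 (by positivity)).add
    ((hasDerivAt_log_ratio h1 h2).div_const 4)).congr_deriv ?_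
  simp only [id]
  field_simp
  ring

lemma sin_eq_tan_half {β : ℝ} (h : Real.cos (β / 2) ≠ 0) :
    Real.sin β = 2 * Real.tan (β / 2) / (1 + Real.tan (β / 2) ^ 2) := by
  have h1 : 1 + Real.tan (β / 2) ^ 2 ≠ 0 := by positivity
  have h2 := Real.sin_sq_add_cos_sq (β / 2)
  rw [eq_div_iff h1, Real.tan_eq_sin_div_cos]
  nth_rewrite 1 [show β = 2 * (β / 2) by ring]
  rw [Real.sin_two_mul]
  field_simp
  linear_combination Real.sin (β / 2) * h2

lemma cos_eq_tan_half {β : ℝ} (h : Real.cos (β / 2) ≠ 0) :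
    Real.cos β = (1 - Real.tan (β / 2) ^ 2) / (1 + Real.tan (β / 2) ^ 2) := by
  have h1 : 1 + Real.tan (β / 2) ^ 2 ≠ 0 := by positivity
  have h2 := Real.sin_sq_add_cos_sq (β / 2)
  rw [eq_div_iff h1, Real.tan_eq_sin_div_cos]
  nth_rewrite 1 [show β = 2 * (β / 2) by ring]
  rw [Real.cos_two_mul]
  field_simp
  linear_combination (2 * Real.cos (β / 2) ^ 2 - 1 + 1) * h2

lemma cos_half_pos {β : ℝ} (h1 : -Real.pi < β) (h2 : β < Real.pi) : 0 < Real.cos (β / 2) :=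
  Real.cos_pos_of_mem_Ioo ⟨by linarith, by linarith⟩

lemma tan_half_pos {β : ℝ} (h1 : 0 < β) (h2 : β < Real.pi) : 0 < Real.tan (β / 2) :=
  Real.tan_pos_of_pos_of_lt_pi_div_two (by linarith) (by linarith)

/-- In terms of `τ = tan (β / 2)`, the pencil function factors on the axis. -/
lemma pencil_eq {ρ β : ℝ} (h : Real.cos (β / 2) ≠ 0) (ht : Real.tan (β / 2) ≠ 0) (x y z : ℝ) :
    pencil ρ β (x, y, z) = Real.sin β *
      (x ^ 2 + y ^ 2 - (ρ * Real.tan (β / 2) - z) * (z + ρ / Real.tan (β / 2))) := by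
  have h1 : 1 + Real.tan (β / 2) ^ 2 ≠ 0 := by positivity
  simp only [pencil, normSq]
  rw [cos_eq_tan_half h, sin_eq_tan_half h]
  field_simp
  ring

lemma continuous_pencil (ρ β : ℝ) : Continuous (pencil ρ β) := by
  unfold pencil normSq
  fun_prop

/-- On a sphere of the pencil the quadratic terms cancel: `1 - |p|²` is affine in the height `z`,
running from `1 - ρ ^ 2` at the rim to `1 - (ρ * τ) ^ 2` at the apex. It is therefore positive in
between, and the slice integral is elementary. -/
lemma integral_lens_slices {ρ τ : ℝ} (hρ : 0 < ρ) (hρ1 : ρ < 1) (hτ : 0 < τ) (hu : ρ * τ < 1) :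
    ∫ z in (0 : ℝ)..(ρ * τ), 4 * Real.pi *
      (1 / (1 - z ^ 2 - (ρ * τ - z) * (z + ρ / τ)) ^ 2 - 1 / (1 - z ^ 2) ^ 2) =
      lensVolume ρ (ρ * τ) := by
  have hu0 : 0 < ρ * τ := mul_pos hρ hτ
  have hr : 0 < 1 - ρ ^ 2 := by nlinarith
  have hlin : ∀ z : ℝ, 1 - z ^ 2 - (ρ * τ - z) * (z + ρ / τ) =
      1 - ρ ^ 2 + ρ * (1 - τ ^ 2) / τ * z := by
    intro z; field_simp; ring
  have hpos : ∀ z ∈ Icc 0 (ρ * τ), 0 < 1 - ρ ^ 2 + ρ * (1 - τ ^ 2) / τ * z := by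
    intro z hz
    have h1 : 1 - ρ ^ 2 + ρ * (1 - τ ^ 2) / τ * z =
      ((1 - ρ ^ 2) * (ρ * τ - z) + (1 - (ρ * τ) ^ 2) * z) / (ρ * τ) := by
      field_simp; ring
    rw [h1]
    have h2 : 0 < 1 - (ρ * τ) ^ 2 := by nlinarith
    rcases eq_or_lt_of_le hz.1 with h | h
    · rw [← h]; simp only [sub_zero, mul_zero, add_zero]; positivity
    · have := mul_nonneg hr.le (sub_nonneg.2 hz.2)
      have := mul_pos h2 h
      positivity
  simp only [hlin]
  have hI : IntervalIntegrable (fun z => 4 * Real.pi *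
      (1 / (1 - ρ ^ 2 + ρ * (1 - τ ^ 2) / τ * z) ^ 2 - 1 / (1 - z ^ 2) ^ 2)) volume 0 (ρ * τ) := by
    apply ContinuousOn.intervalIntegrable
    rw [uIcc_of_le hu0.le]
    refine continuousOn_const.mul (ContinuousOn.sub ?_ ?_)
    · exact ContinuousOn.div continuousOn_const (by fun_prop)
        fun z hz => pow_ne_zero 2 (hpos z hz).ne'
    · exact ContinuousOn.div continuousOn_const (by fun_prop)
        fun z hz => pow_ne_zero 2 (by nlinarith [hz.1, hz.2])
  -- The primitive of `1 / (A + K z) ^ 2` is taken as `z / (A (A + K z))`, which stays valid when `K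
  -- = 0`, that is, for `τ = 1`.
  rw [intervalIntegral.integral_eq_sub_of_hasDerivAt (f := fun z => 4 * Real.pi *
      (z / ((1 - ρ ^ 2) * (1 - ρ ^ 2 + ρ * (1 - τ ^ 2) / τ * z)) -
        (z / (2 * (1 - z ^ 2)) + (Real.log (1 + z) - Real.log (1 - z)) / 4))) _ hI]
  · have h3 : 1 - ρ ^ 2 + ρ * (1 - τ ^ 2) / τ * (ρ * τ) = 1 - (ρ * τ) ^ 2 := by
      field_simp; ring
    have h2 : 0 < 1 - (ρ * τ) ^ 2 := by nlinarith
    simp only [h3]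
    unfold lensVolume
    simp only [add_zero, sub_zero, sub_self, zero_div, mul_zero]
    generalize Real.log (1 + ρ * τ) = l1
    generalize Real.log (1 - ρ * τ) = l2
    generalize ρ * τ = u at *
    field_simp
    ring
  · intro z hz
    rw [uIcc_of_le hu0.le] at hz
    have hp := hpos z hz
    have h1 : HasDerivAt (fun z : ℝ => (1 - ρ ^ 2) * (1 - ρ ^ 2 + ρ * (1 - τ ^ 2) / τ * z))
        ((1 - ρ ^ 2) * (ρ * (1 - τ ^ 2) / τ)) z := by
      simpa using (((hasDerivAt_id z).const_mul (ρ * (1 - τ ^ 2) / τ)).const_add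
        (1 - ρ ^ 2)).const_mul (1 - ρ ^ 2)
    refine ((((hasDerivAt_id z).div h1 (by positivity)).sub (hasDerivAt_density_primitive
      (by linarith [hz.1]) (by linarith [hz.2]))).const_mul (4 * Real.pi)).congr_deriv ?_
    congr 2
    simp only [id]
    generalize ρ * (1 - τ ^ 2) / τ = K at *
    field_simp
    ring

lemma lens_slice_lt {ρ τ z : ℝ} (hρ : 0 < ρ) (hρ1 : ρ < 1) (hτ : 0 < τ) (hu : ρ * τ < 1)
    (hz : z ∈ Icc 0 (ρ * τ)) : (ρ * τ - z) * (z + ρ / τ) < 1 - z ^ 2 := by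
  have h1 : 1 - z ^ 2 - (ρ * τ - z) * (z + ρ / τ) =
    ((1 - ρ ^ 2) * (ρ * τ - z) + (1 - (ρ * τ) ^ 2) * z) / (ρ * τ) := by
    field_simp; ring
  have hu0 : 0 < ρ * τ := mul_pos hρ hτ
  have hr : 0 < 1 - ρ ^ 2 := by nlinarith
  have h2 : 0 < 1 - (ρ * τ) ^ 2 := by nlinarith
  have h3 : 0 < (1 - ρ ^ 2) * (ρ * τ - z) + (1 - (ρ * τ) ^ 2) * z := by
    rcases eq_or_lt_of_le hz.1 with h | h
    · rw [← h]; simp only [sub_zero, mul_zero, add_zero]; positivity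
    · have := mul_nonneg hr.le (sub_nonneg.2 hz.2)
      have := mul_pos h2 h
      positivity
  have := div_pos h3 hu0
  linarith

lemma capVolume_nonneg {ρ β : ℝ} (hρ : 0 < ρ) (hρ1 : ρ < 1) (h0 : 0 < β) (hπ : β < Real.pi)
    (hu : ρ * Real.tan (β / 2) < 1) : 0 ≤ capVolume ρ β := by
  have hτ := tan_half_pos h0 hπ
  rw [capVolume, ← integral_lens_slices hρ hρ1 hτ hu]
  refine intervalIntegral.integral_nonneg (mul_pos hρ hτ).le fun z hz => ?_
  have h3 := lens_slice_lt hρ hρ1 hτ hu hz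
  have h4 : 0 ≤ (ρ * Real.tan (β / 2) - z) * (z + ρ / Real.tan (β / 2)) :=
    mul_nonneg (by linarith [hz.2]) (add_nonneg hz.1 (by positivity))
  refine mul_nonneg (by positivity) (sub_nonneg.2 ?_)
  exact one_div_le_one_div_of_le (pow_pos (by linarith) 2)
      (pow_le_pow_left₀ (by linarith) (by linarith) 2)

/-- Volume of the region between the flat disc and a cap, up to boundary points. -/
theorem hypVolume_cap {ρ β : ℝ} (hρ : 0 < ρ) (hρ1 : ρ < 1) (h0 : 0 < β) (hπ : β < Real.pi)
    (hu : ρ * Real.tan (β / 2) < 1) {S : Set (ℝ × ℝ × ℝ)} (hS : MeasurableSet S)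
    (h1 : ∀ p : ℝ × ℝ × ℝ, 0 < p.2.2 → pencil ρ β p < 0 → p ∈ S)
    (h2 : ∀ p ∈ S, 0 ≤ p.2.2 ∧ pencil ρ β p ≤ 0) :
    hypVolume S = ENNReal.ofReal (capVolume ρ β) := by
  have hτ := tan_half_pos h0 hπ
  have hc := (cos_half_pos (by linarith) hπ).ne'
  have hs := Real.sin_pos_of_pos_of_lt_pi h0 hπ
  have hu0 := mul_pos hρ hτ
  rw [capVolume, ← integral_lens_slices hρ hρ1 hτ hu]
  refine hypVolume_of_slices hu0.le hS ?_ ?_ ?_ ?_ ?_ ?_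
  · intro z hz
    exact mul_nonneg (by linarith [hz.2]) (add_nonneg hz.1.le (by positivity))
  · intro z hz
    exact lens_slice_lt hρ hρ1 hτ hu hz
  · intro z hz; nlinarith [hz.1, hz.2]
  · fun_prop
  · intro x y z hz hlt
    refine h1 _ hz.1 ?_
    rw [pencil_eq hc hτ.ne']
    exact mul_neg_of_pos_of_neg hs (by linarith)
  · intro x y z hp
    obtain ⟨hz, hle⟩ := h2 _ hp
    simp only at hz
    rw [pencil_eq hc hτ.ne'] at hle
    have h3 : x ^ 2 + y ^ 2 ≤
        (ρ * Real.tan (β / 2) - z) * (z + ρ / Real.tan (β / 2)) := by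
      by_contra! hcon
      exact absurd hle (not_le.2 (mul_pos hs (by linarith)))
    refine ⟨⟨hz, ?_⟩, h3⟩
    by_contra! hcon
    have h4 : 0 < z + ρ / Real.tan (β / 2) := by positivity
    have h5 := mul_neg_of_neg_of_pos (sub_neg.2 hcon) h4
    nlinarith [sq_nonneg x, sq_nonneg y]

/-- Reflection in the plane `z = 0`. -/
def mirror (p : ℝ × ℝ × ℝ) : ℝ × ℝ × ℝ := (p.1, p.2.1, -p.2.2)

lemma measurable_mirror : Measurable mirror := by unfold mirror; fun_prop

lemma pencil_mirror (ρ β : ℝ) (p : ℝ × ℝ × ℝ) :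
    pencil ρ β (mirror p) = -pencil ρ (-β) p := by
  simp only [pencil, mirror, normSq, Real.sin_neg, Real.cos_neg]
  ring

lemma hypVolume_mirror {S : Set (ℝ × ℝ × ℝ)} (hS : MeasurableSet S) :
    hypVolume (mirror ⁻¹' S) = hypVolume S := by
  have hmp : MeasurePreserving mirror volume volume :=
    (MeasurePreserving.id volume).prod
      ((MeasurePreserving.id volume).prod (Measure.measurePreserving_neg volume))
  have hmd : Measurable (fun p : ℝ × ℝ × ℝ => ENNReal.ofReal ((2 / (1 - normSq p)) ^ 3)) := by
    unfold normSq
    fun_prop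
  have hH : MeasurableSet hypSpace := by
    refine measurableSet_lt ?_ measurable_const
    unfold normSq
    fun_prop
  rw [hypVolume, withDensity_apply _ hS, withDensity_apply _ (measurable_mirror hS),
    Measure.restrict_restrict hS, Measure.restrict_restrict (measurable_mirror hS),
    ← lintegral_indicator (hS.inter hH), ← lintegral_indicator ((measurable_mirror hS).inter hH),
    ← hmp.lintegral_comp (hmd.indicator (hS.inter hH))]
  refine lintegral_congr fun p => ?_
  have hn : normSq (mirror p) = normSq p := by simp [normSq, mirror]
  have hiff : mirror p ∈ hypSpace ↔ p ∈ hypSpace := by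
    simp only [hypSpace, mem_ofPred_eq, hn]
  by_cases h : p ∈ mirror ⁻¹' S ∩ hypSpace
  · rw [indicator_of_mem h, indicator_of_mem (show mirror p ∈ S ∩ hypSpace from
      ⟨h.1, hiff.2 h.2⟩), hn]
  · rw [indicator_of_notMem h, indicator_of_notMem (show mirror p ∉ S ∩ hypSpace from
      fun h' => h ⟨h'.1, hiff.1 h'.2⟩)]

lemma measurableSet_upperRegion (ρ θ : ℝ) : MeasurableSet (upperRegion ρ θ) :=
  (measurableSet_lt (continuous_pencil _ _).measurable measurable_const).inter
    (measurableSet_lt measurable_const (continuous_pencil _ _).measurable)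

lemma lowerRegion_eq_mirror (ρ θ : ℝ) : lowerRegion ρ θ = mirror ⁻¹' upperRegion ρ (-θ) := by
  ext p
  simp only [lowerRegion, upperRegion, mem_preimage, mem_ofPred_eq, pencil_mirror, neg_neg,
    Left.neg_neg_iff, Left.neg_pos_iff]
  rw [show -(-θ + 2 * Real.pi / 3) = θ - 2 * Real.pi / 3 by ring]

/-- Two caps of the pencil over the same disc are nested. -/
lemma pencil_nested {ρ α β : ℝ} (hρ : 0 < ρ) (h0 : 0 < α) (h1 : α < β) (h2 : β < Real.pi)
    {p : ℝ × ℝ × ℝ} (hz : 0 ≤ p.2.2) (hp : pencil ρ α p ≤ 0) : pencil ρ β p < 0 ∨ p.2.2 = 0 := by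
  rcases hz.eq_or_lt with hz | hz
  · exact Or.inr hz.symm
  left
  have hs1 := Real.sin_pos_of_pos_of_lt_pi h0 (by linarith)
  have hs2 := Real.sin_pos_of_pos_of_lt_pi (by linarith) h2
  have hs3 := Real.sin_pos_of_pos_of_lt_pi (sub_pos.2 h1) (by linarith)
  have h3 : Real.sin α * pencil ρ β p =
      Real.sin β * pencil ρ α p - 2 * ρ * p.2.2 * Real.sin (β - α) := by
    rw [Real.sin_sub]; simp only [pencil]; ring
  have h4 : Real.sin α * pencil ρ β p < 0 := by
    rw [h3]
    have := mul_nonpos_of_nonneg_of_nonpos hs2.le hp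
    have : 0 < 2 * ρ * p.2.2 * Real.sin (β - α) := by positivity
    linarith
  exact neg_of_mul_neg_right h4 hs1.le

/-- The chamber is the cap over the disc with the lens under the separating cap removed (`θ > 0`) or
a lens below the disc added (`θ < 0`). The oddness of `capVolume` in the angle gives one formula for
both. -/
lemma hypVolume_upperRegion {ρ θ : ℝ} (hρ : 0 < ρ) (hρ1 : ρ < 1) (hθ : -(Real.pi / 3) < θ)
    (hθ' : θ < Real.pi / 3) (hu : ρ * Real.tan ((θ + 2 * Real.pi / 3) / 2) < 1) :
    hypVolume (upperRegion ρ θ) =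
      ENNReal.ofReal (capVolume ρ (θ + 2 * Real.pi / 3) - capVolume ρ θ) := by
  have hpi := Real.pi_pos
  have ha0 : 0 < θ + 2 * Real.pi / 3 := by linarith
  have haπ : θ + 2 * Real.pi / 3 < Real.pi := by linarith
  have hsa := Real.sin_pos_of_pos_of_lt_pi ha0 haπ
  have hm (β : ℝ) : Measurable (pencil ρ β) := (continuous_pencil _ _).measurable
  have hmz : Measurable fun p : ℝ × ℝ × ℝ => p.2.2 := by fun_prop
  -- Two members of the pencil differ by a multiple of `z`, so their signs are comparable on each
  -- side of the disc.
  have hrel : ∀ p, Real.sin (θ + 2 * Real.pi / 3) * pencil ρ θ p =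
      Real.sin θ * pencil ρ (θ + 2 * Real.pi / 3) p +
        2 * ρ * p.2.2 * Real.sin (2 * Real.pi / 3) := by
    intro p
    have : Real.sin (2 * Real.pi / 3) = Real.sin ((θ + 2 * Real.pi / 3) - θ) := by ring_nf
    rw [this, Real.sin_sub]; simp only [pencil]; ring
  have hs3 : 0 < Real.sin (2 * Real.pi / 3) :=
    Real.sin_pos_of_pos_of_lt_pi (by linarith) (by linarith)
  rcases lt_trichotomy θ 0 with h | h | h
  -- The separating cap hangs below the disc: the chamber splits along `z = 0` into the outer cap
  -- and a reflected lens.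
  · have hsθ : Real.sin θ < 0 := Real.sin_neg_of_neg_of_neg_pi_lt h (by linarith)
    have hu' : ρ * Real.tan (-θ / 2) < 1 := by
      refine lt_of_le_of_lt (mul_le_mul_of_nonneg_left ?_ hρ.le) hu
      refine (Real.tan_lt_tan_of_lt_of_lt_pi_div_two ?_ ?_ ?_).le <;> linarith
    have hdis : Disjoint {p | 0 ≤ p.2.2 ∧ pencil ρ (θ + 2 * Real.pi / 3) p < 0}
        (mirror ⁻¹' {p | 0 < p.2.2 ∧ pencil ρ (-θ) p < 0}) := by
      rw [Set.disjoint_left]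
      intro p hp hp'
      have h3 := hp.1
      have h4 : 0 < -p.2.2 := hp'.1
      linarith
    have hmB : MeasurableSet {p : ℝ × ℝ × ℝ | 0 < p.2.2 ∧ pencil ρ (-θ) p < 0} :=
      (measurableSet_lt measurable_const hmz).inter (measurableSet_lt (hm _) measurable_const)
    have heq : upperRegion ρ θ = {p | 0 ≤ p.2.2 ∧ pencil ρ (θ + 2 * Real.pi / 3) p < 0} ∪
        mirror ⁻¹' {p | 0 < p.2.2 ∧ pencil ρ (-θ) p < 0} := by
      ext p
      simp only [upperRegion, mem_union, mem_preimage, mem_ofPred_eq, pencil_mirror, neg_neg,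
        Left.neg_neg_iff]
      have hr := hrel p
      constructor
      · rintro ⟨h3, h4⟩
        rcases le_or_gt 0 p.2.2 with hz | hz
        · exact Or.inl ⟨hz, h3⟩
        · exact Or.inr ⟨by simpa [mirror] using hz, h4⟩
      · rintro (⟨hz, h3⟩ | ⟨hz, h4⟩)
        · refine ⟨h3, ?_⟩
          have h5 : 0 < Real.sin (θ + 2 * Real.pi / 3) * pencil ρ θ p := by
            rw [hr]
            have := mul_pos_of_neg_of_neg hsθ h3
            have : 0 ≤ 2 * ρ * p.2.2 * Real.sin (2 * Real.pi / 3) := by positivity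
            linarith
          exact pos_of_mul_pos_right h5 hsa.le
        · refine ⟨?_, h4⟩
          have hz' : p.2.2 < 0 := by simpa [mirror] using hz
          have h5 : Real.sin θ * pencil ρ (θ + 2 * Real.pi / 3) p > 0 := by
            have h6 := mul_pos hsa h4
            have h7 : 2 * ρ * p.2.2 * Real.sin (2 * Real.pi / 3) < 0 :=
              mul_neg_of_neg_of_pos (mul_neg_of_pos_of_neg (by positivity) hz') hs3
            linarith
          exact neg_of_mul_pos_right h5 hsθ.le
    rw [heq, measure_union hdis (measurable_mirror hmB), hypVolume_mirror hmB,
      hypVolume_cap hρ hρ1 ha0 haπ hu, hypVolume_cap hρ hρ1 (neg_pos.2 h) (by linarith) hu' hmB,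
      ← ENNReal.ofReal_add, capVolume_neg, ← sub_eq_add_neg]
    · exact capVolume_nonneg hρ hρ1 ha0 haπ hu
    · exact capVolume_nonneg hρ hρ1 (neg_pos.2 h) (by linarith) hu'
    · exact fun p h3 h4 => ⟨h3, h4⟩
    · exact fun p hp => ⟨hp.1.le, hp.2.le⟩
    · exact (measurableSet_le measurable_const hmz).inter
        (measurableSet_lt (hm _) measurable_const)
    · exact fun p h3 h4 => ⟨h3.le, h4⟩
    · exact fun p hp => ⟨hp.1, hp.2.le⟩
  · subst h
    have h0 : capVolume ρ 0 = 0 := by simp [capVolume, lensVolume]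
    rw [h0, sub_zero]
    refine hypVolume_cap hρ hρ1 ha0 haπ hu (measurableSet_upperRegion _ _) ?_ ?_
    · intro p h3 h4
      exact ⟨h4, by simp only [pencil, Real.sin_zero, Real.cos_zero]; nlinarith⟩
    · rintro p ⟨h3, h4⟩
      simp only [pencil, Real.sin_zero, Real.cos_zero, zero_mul, zero_add, mul_one] at h4
      exact ⟨(pos_of_mul_pos_right h4 (by positivity)).le, h3.le⟩
  -- The separating cap lies above the disc and inside the outer cap: the chamber is a difference of
  -- two nested lenses.
  · have hsθ : 0 < Real.sin θ := Real.sin_pos_of_pos_of_lt_pi h (by linarith)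
    have hu' : ρ * Real.tan (θ / 2) < 1 := by
      refine lt_of_le_of_lt (mul_le_mul_of_nonneg_left ?_ hρ.le) hu
      refine (Real.tan_lt_tan_of_lt_of_lt_pi_div_two ?_ ?_ ?_).le <;> linarith
    have hmB : MeasurableSet {p : ℝ × ℝ × ℝ | 0 < p.2.2 ∧ pencil ρ θ p ≤ 0} :=
      (measurableSet_lt measurable_const hmz).inter (measurableSet_le (hm _) measurable_const)
    have heq : upperRegion ρ θ = {p | 0 < p.2.2 ∧ pencil ρ (θ + 2 * Real.pi / 3) p < 0} \
        {p | 0 < p.2.2 ∧ pencil ρ θ p ≤ 0} := by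
      ext p
      simp only [upperRegion, mem_sdiff, mem_ofPred_eq]
      have hr := hrel p
      constructor
      · rintro ⟨h3, h4⟩
        have hz : 0 < p.2.2 := by
          have h5 := mul_pos hsa h4
          have h6 := mul_neg_of_pos_of_neg hsθ h3
          have h7 : 0 < p.2.2 * (2 * ρ * Real.sin (2 * Real.pi / 3)) := by linarith
          exact pos_of_mul_pos_left h7 (by positivity)
        exact ⟨⟨hz, h3⟩, fun h5 => absurd h5.2 (not_le.2 h4)⟩
      · rintro ⟨⟨hz, h3⟩, h4⟩
        exact ⟨h3, not_le.1 fun h5 => h4 ⟨hz, h5⟩⟩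
    have hsub : {p : ℝ × ℝ × ℝ | 0 < p.2.2 ∧ pencil ρ θ p ≤ 0} ⊆
        {p | 0 < p.2.2 ∧ pencil ρ (θ + 2 * Real.pi / 3) p < 0} := by
      rintro p ⟨hz, h3⟩
      refine ⟨hz, ?_⟩
      rcases pencil_nested hρ h (by linarith) haπ hz.le h3 with h4 | h4
      · exact h4
      · exact absurd h4 hz.ne'
    have hB : hypVolume {p : ℝ × ℝ × ℝ | 0 < p.2.2 ∧ pencil ρ θ p ≤ 0} =
        ENNReal.ofReal (capVolume ρ θ) :=
      hypVolume_cap hρ hρ1 h (by linarith) hu' hmB (fun p h3 h4 => ⟨h3, h4.le⟩)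
        (fun p hp => ⟨hp.1.le, hp.2⟩)
    rw [heq, measure_sdiff hsub hmB.nullMeasurableSet (by rw [hB]; exact ENNReal.ofReal_ne_top), hB,
      hypVolume_cap hρ hρ1 ha0 haπ hu, ← ENNReal.ofReal_sub _
        (capVolume_nonneg hρ hρ1 h (by linarith) hu')]
    · exact (measurableSet_lt measurable_const hmz).inter
        (measurableSet_lt (hm _) measurable_const)
    · exact fun p h3 h4 => ⟨h3, h4⟩
    · exact fun p hp => ⟨hp.1.le, hp.2.le⟩

lemma hypVolume_lowerRegion {ρ θ : ℝ} (hρ : 0 < ρ) (hρ1 : ρ < 1) (hθ : -(Real.pi / 3) < θ)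
    (hθ' : θ < Real.pi / 3) (hu : ρ * Real.tan ((2 * Real.pi / 3 - θ) / 2) < 1) :
    hypVolume (lowerRegion ρ θ) =
      ENNReal.ofReal (capVolume ρ (2 * Real.pi / 3 - θ) + capVolume ρ θ) := by
  have h : -θ + 2 * Real.pi / 3 = 2 * Real.pi / 3 - θ := by ring
  rw [lowerRegion_eq_mirror, hypVolume_mirror (measurableSet_upperRegion _ _),
    hypVolume_upperRegion hρ hρ1 (by linarith) (by linarith) (by rwa [h]), h, capVolume_neg,
    sub_neg_eq_add]

lemma hypVolume_roundBall {R : ℝ} (h0 : 0 < R) (h1 : R < 1) :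
    hypVolume (roundBall R) = ENNReal.ofReal (4 * Real.pi * (R * (1 + R ^ 2) / (1 - R ^ 2) ^ 2) -
      2 * Real.pi * (Real.log (1 + R) - Real.log (1 - R))) := by
  have hR : 0 < 1 - R ^ 2 := by nlinarith
  have hS : MeasurableSet (roundBall R) := by
    refine measurableSet_lt ?_ measurable_const
    unfold normSq
    fun_prop
  rw [hypVolume_of_slices (a := -R) (b := R) (f := fun z => R ^ 2 - z ^ 2) (by linarith) hS]
  · congr 1
    simp only [show ∀ z : ℝ, 1 - z ^ 2 - (R ^ 2 - z ^ 2) = 1 - R ^ 2 by intro z; ring]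
    rw [intervalIntegral.integral_eq_sub_of_hasDerivAt (f := fun z => 4 * Real.pi *
      (1 / (1 - R ^ 2) ^ 2 * z -
        (z / (2 * (1 - z ^ 2)) + (Real.log (1 + z) - Real.log (1 - z)) / 4)))]
    · rw [neg_sq, sub_neg_eq_add, ← sub_eq_add_neg]
      field_simp
      ring
    · intro z hz
      rw [uIcc_of_le (by linarith)] at hz
      exact ((((hasDerivAt_id z).const_mul (1 / (1 - R ^ 2) ^ 2)).sub
        (hasDerivAt_density_primitive (by linarith [hz.1]) (by linarith [hz.2]))).const_mul
          (4 * Real.pi)).congr_deriv (by rw [mul_one])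
    · apply ContinuousOn.intervalIntegrable
      rw [uIcc_of_le (by linarith)]
      refine continuousOn_const.mul (ContinuousOn.sub continuousOn_const ?_)
      exact ContinuousOn.div continuousOn_const (by fun_prop)
        fun z hz => pow_ne_zero 2 (by nlinarith [hz.1, hz.2])
  · intro z hz; nlinarith [hz.1, hz.2]
  · intro z hz; linarith
  · intro z hz; nlinarith [hz.1, hz.2]
  · fun_prop
  · intro x y z hz hlt
    simp only [roundBall, normSq, mem_ofPred_eq]
    linarith
  · intro x y z hp
    simp only [roundBall, normSq, mem_ofPred_eq] at hp
    refine ⟨abs_le.1 (abs_le_of_sq_le_sq (by nlinarith [sq_nonneg x, sq_nonneg y]) h0.le), ?_⟩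
    linarith

/-! ### Areas -/

lemma roundSphereArea_eq {R : ℝ} (h0 : 0 < R) :
    roundSphereArea R = 16 * Real.pi * R ^ 2 / (1 - R ^ 2) ^ 2 := by
  have hd1 : ∀ t, deriv (fun t => R * Real.sin t) t = R * Real.cos t := fun t =>
    ((Real.hasDerivAt_sin t).const_mul R).deriv
  have hd2 : ∀ t, deriv (fun t => R * Real.cos t) t = R * -Real.sin t := fun t =>
    ((Real.hasDerivAt_cos t).const_mul R).deriv
  have h : ∀ t : ℝ, 2 * Real.pi * (R * Real.sin t) *
      √(deriv (fun t => R * Real.sin t) t ^ 2 + deriv (fun t => R * Real.cos t) t ^ 2) *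
      (2 / (1 - (R * Real.sin t) ^ 2 - (R * Real.cos t) ^ 2)) ^ 2 =
      8 * Real.pi * R ^ 2 / (1 - R ^ 2) ^ 2 * Real.sin t := by
    intro t
    have h1 := Real.sin_sq_add_cos_sq t
    rw [hd1, hd2, show (R * Real.cos t) ^ 2 + (R * -Real.sin t) ^ 2 = R ^ 2 by
      linear_combination R ^ 2 * h1, Real.sqrt_sq h0.le,
      show 1 - (R * Real.sin t) ^ 2 - (R * Real.cos t) ^ 2 = 1 - R ^ 2 by
      linear_combination -R ^ 2 * h1]
    rw [div_pow]
    ring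
  rw [roundSphereArea, hypRevolutionArea]
  simp only [h]
  rw [intervalIntegral.integral_const_mul, integral_sin, Real.cos_zero, Real.cos_pi]
  ring

/-- In the rational parametrization of the arc, the squared speed is a perfect square and the
conformal factor has a denominator quadratic in `t`, so the integrand is of the form `t / (A + B t ^
2) ^ 2`. -/
lemma capArea_eq {ρ β : ℝ} (h0 : 0 < ρ) (h1 : ρ < 1) (hu : (ρ * Real.tan (β / 2)) ^ 2 < 1) :
    capArea ρ β = 4 * Real.pi * ((ρ ^ 2 + (ρ * Real.tan (β / 2)) ^ 2) /
      ((1 - ρ ^ 2) * (1 - (ρ * Real.tan (β / 2)) ^ 2))) := by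
  rw [capArea, hypRevolutionArea]
  generalize Real.tan (β / 2) = τ at *
  have hr : 0 < 1 - ρ ^ 2 := by nlinarith
  have hu' : 0 < 1 - ρ ^ 2 * τ ^ 2 := by nlinarith
  have hq : ∀ t : ℝ, 1 + τ ^ 2 * t ^ 2 ≠ 0 := fun t => by positivity
  have hdq : ∀ t : ℝ, HasDerivAt (fun t : ℝ => 1 + τ ^ 2 * t ^ 2) (τ ^ 2 * (2 * t)) t := by
    intro t
    simpa using (((hasDerivAt_id t).pow 2).const_mul (τ ^ 2)).const_add 1
  have hd1 : ∀ t, deriv (fun t => ρ * t * (1 + τ ^ 2) / (1 + τ ^ 2 * t ^ 2)) t =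
      ρ * (1 + τ ^ 2) * (1 - τ ^ 2 * t ^ 2) / (1 + τ ^ 2 * t ^ 2) ^ 2 := by
    intro t
    refine ((((((hasDerivAt_id t).const_mul ρ).mul_const (1 + τ ^ 2)).div (hdq t)
      (hq t))).congr_deriv ?_).deriv
    simp only [id]
    congr 1
    ring
  have hd2 : ∀ t, deriv (fun t => ρ * τ * (1 - t ^ 2) / (1 + τ ^ 2 * t ^ 2)) t =
      -(2 * ρ * τ * t * (1 + τ ^ 2)) / (1 + τ ^ 2 * t ^ 2) ^ 2 := by
    intro t
    refine (((((((hasDerivAt_id t).pow 2).const_sub 1).const_mul (ρ * τ)).div (hdq t)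
      (hq t))).congr_deriv ?_).deriv
    simp only [id, Pi.pow_apply]
    congr 1
    norm_num
    ring
  have hpos : ∀ t ∈ Icc (0 : ℝ) 1, 0 < 1 - ρ ^ 2 * τ ^ 2 + (τ ^ 2 - ρ ^ 2) * t ^ 2 := by
    intro t ht
    have h2 : t ^ 2 ≤ 1 := by nlinarith [ht.1, ht.2]
    have h3 : 1 - ρ ^ 2 * τ ^ 2 + (τ ^ 2 - ρ ^ 2) * t ^ 2 =
      (1 - ρ ^ 2 * τ ^ 2) * (1 - t ^ 2) + (1 + τ ^ 2) * (1 - ρ ^ 2) * t ^ 2 := by ring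
    rw [h3]
    rcases (sq_nonneg t).eq_or_lt with h | h
    · rw [← h]; simpa using hu'
    · have := mul_nonneg hu'.le (sub_nonneg.2 h2)
      have : 0 < (1 + τ ^ 2) * (1 - ρ ^ 2) * t ^ 2 := by positivity
      linarith
  have hcongr : ∀ t ∈ uIcc (0 : ℝ) 1, 2 * Real.pi *
      (ρ * t * (1 + τ ^ 2) / (1 + τ ^ 2 * t ^ 2)) *
      √(deriv (fun t => ρ * t * (1 + τ ^ 2) / (1 + τ ^ 2 * t ^ 2)) t ^ 2 +
        deriv (fun t => ρ * τ * (1 - t ^ 2) / (1 + τ ^ 2 * t ^ 2)) t ^ 2) *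
      (2 / (1 - (ρ * t * (1 + τ ^ 2) / (1 + τ ^ 2 * t ^ 2)) ^ 2 -
        (ρ * τ * (1 - t ^ 2) / (1 + τ ^ 2 * t ^ 2)) ^ 2)) ^ 2 =
      8 * Real.pi * ρ ^ 2 * (1 + τ ^ 2) ^ 2 * t /
        (1 - ρ ^ 2 * τ ^ 2 + (τ ^ 2 - ρ ^ 2) * t ^ 2) ^ 2 := by
    intro t ht
    rw [uIcc_of_le zero_le_one] at ht
    have hp := hpos t ht
    have hqt := hq t
    have hq0 : 0 < 1 + τ ^ 2 * t ^ 2 := by positivity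
    rw [hd1, hd2]
    have hs : (ρ * (1 + τ ^ 2) * (1 - τ ^ 2 * t ^ 2) / (1 + τ ^ 2 * t ^ 2) ^ 2) ^ 2 +
        (-(2 * ρ * τ * t * (1 + τ ^ 2)) / (1 + τ ^ 2 * t ^ 2) ^ 2) ^ 2 =
        (ρ * (1 + τ ^ 2) / (1 + τ ^ 2 * t ^ 2)) ^ 2 := by
      field_simp
      ring
    have hden : 1 - (ρ * t * (1 + τ ^ 2) / (1 + τ ^ 2 * t ^ 2)) ^ 2 -
        (ρ * τ * (1 - t ^ 2) / (1 + τ ^ 2 * t ^ 2)) ^ 2 =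
        (1 - ρ ^ 2 * τ ^ 2 + (τ ^ 2 - ρ ^ 2) * t ^ 2) / (1 + τ ^ 2 * t ^ 2) := by
      field_simp
      ring
    rw [hs, hden, Real.sqrt_sq (by positivity)]
    field_simp
    ring
  rw [intervalIntegral.integral_congr hcongr]
  -- A primitive with `t ^ 2` in the numerator avoids dividing by `τ ^ 2 - ρ ^ 2`, which may vanish.
  rw [intervalIntegral.integral_eq_sub_of_hasDerivAt (f := fun t =>
    4 * Real.pi * ρ ^ 2 * (1 + τ ^ 2) ^ 2 / (1 - ρ ^ 2 * τ ^ 2) * (t ^ 2 /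
      (1 - ρ ^ 2 * τ ^ 2 + (τ ^ 2 - ρ ^ 2) * t ^ 2)))]
  · have h3 : 1 - ρ ^ 2 * τ ^ 2 + (τ ^ 2 - ρ ^ 2) * 1 ^ 2 = (1 + τ ^ 2) * (1 - ρ ^ 2) := by ring
    rw [h3]
    field_simp
    ring
  · intro t ht
    rw [uIcc_of_le zero_le_one] at ht
    have hp := (hpos t ht).ne'
    have h3 : HasDerivAt (fun t : ℝ => 1 - ρ ^ 2 * τ ^ 2 + (τ ^ 2 - ρ ^ 2) * t ^ 2)
        ((τ ^ 2 - ρ ^ 2) * (2 * t)) t := by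
      simpa using (((hasDerivAt_id t).pow 2).const_mul (τ ^ 2 - ρ ^ 2)).const_add
        (1 - ρ ^ 2 * τ ^ 2)
    refine ((((hasDerivAt_id t).pow 2).div h3 hp).const_mul _).congr_deriv ?_
    simp only [id, Pi.pow_apply]
    field_simp
    norm_num
    ring
  · apply ContinuousOn.intervalIntegrable
    rw [uIcc_of_le zero_le_one]
    exact ContinuousOn.div (by fun_prop) (by fun_prop)
      fun t ht => pow_ne_zero 2 (hpos t ht).ne'

/-- The area of the cap with boundary circle of Euclidean radius `ρ` and apex `(0, 0, u)`. -/
noncomputable def lensArea (ρ u : ℝ) : ℝ :=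
  4 * Real.pi * ((ρ ^ 2 + u ^ 2) / ((1 - ρ ^ 2) * (1 - u ^ 2)))

/-- Twice the mean curvature of the cap that makes the angle `β` with the flat disc. -/
noncomputable def capPressure (ρ β : ℝ) : ℝ := (1 + ρ ^ 2) / ρ * Real.sin β

/-- Minus the derivative of the volume of a cap with respect to its pressure, at fixed angle. -/
noncomputable def capStiffness (ρ τ : ℝ) : ℝ :=
  Real.pi * ρ ^ 2 * (1 + τ ^ 2) / (1 - ρ ^ 2) ^ 3 * (2 * ρ ^ 2 *
    (2 * (1 - ρ ^ 2) * (1 - (ρ * τ) ^ 2) + (1 + ρ ^ 2) * ((1 - (ρ * τ) ^ 2) + τ ^ 2 * (1 - ρ ^ 2)))) /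
    (1 - (ρ * τ) ^ 2) ^ 2

lemma capStiffness_pos {ρ τ : ℝ} (h0 : 0 < ρ) (h1 : ρ < 1) (hu : (ρ * τ) ^ 2 < 1) :
    0 < capStiffness ρ τ := by
  have hr : 0 < 1 - ρ ^ 2 := by nlinarith
  have hu' : 0 < 1 - (ρ * τ) ^ 2 := by linarith
  unfold capStiffness
  positivity

/-! ### First variation of a single cap -/

section
variable {ρ β : ℝ → ℝ} {ρ' β' s : ℝ}

lemma hasDerivAt_lensVolume {u : ℝ → ℝ} {u' : ℝ} (hρ : HasDerivAt ρ ρ' s) (hu : HasDerivAt u u' s)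
    (h1 : ρ s ^ 2 < 1) (h2 : u s ^ 2 < 1) :
    HasDerivAt (fun s => lensVolume (ρ s) (u s))
      (2 * Real.pi * (u s / (1 - u s ^ 2) * (4 * ρ s / (1 - ρ s ^ 2) ^ 2)) * ρ' +
        (2 * Real.pi * ((1 + ρ s ^ 2) / (1 - ρ s ^ 2) * ((1 + u s ^ 2) / (1 - u s ^ 2) ^ 2)) -
          2 * Real.pi / (1 - u s ^ 2)) * u') s := by
  have hr : 1 - ρ s ^ 2 ≠ 0 := by linarith
  have hu2 : 1 - u s ^ 2 ≠ 0 := by linarith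
  have hb := abs_lt.1 ((sq_lt_one_iff_abs_lt_one _).1 h2)
  have hl := (hasDerivAt_log_ratio hb.1 hb.2).comp s hu
  have hd := ((hρ.pow 2).const_sub 1).mul ((hu.pow 2).const_sub 1)
  have hn := hu.mul ((hρ.pow 2).const_add 1)
  refine (((hn.div hd (mul_ne_zero hr hu2)).const_mul (2 * Real.pi)).sub
    (hl.const_mul Real.pi)).congr_deriv ?_
  simp only [Pi.pow_apply, Pi.mul_apply]
  field_simp
  norm_num
  ring

lemma hasDerivAt_lensArea {u : ℝ → ℝ} {u' : ℝ} (hρ : HasDerivAt ρ ρ' s) (hu : HasDerivAt u u' s)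
    (h1 : ρ s ^ 2 < 1) (h2 : u s ^ 2 < 1) :
    HasDerivAt (fun s => lensArea (ρ s) (u s))
      (8 * Real.pi * (ρ s * (1 + u s ^ 2) / ((1 - ρ s ^ 2) ^ 2 * (1 - u s ^ 2)) * ρ' +
        u s * (1 + ρ s ^ 2) / ((1 - ρ s ^ 2) * (1 - u s ^ 2) ^ 2) * u')) s := by
  have hr : 1 - ρ s ^ 2 ≠ 0 := by linarith
  have hu2 : 1 - u s ^ 2 ≠ 0 := by linarith
  have hd := ((hρ.pow 2).const_sub 1).mul ((hu.pow 2).const_sub 1)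
  have hn := (hρ.pow 2).add (hu.pow 2)
  refine ((hn.div hd (mul_ne_zero hr hu2)).const_mul (4 * Real.pi)).congr_deriv ?_
  simp only [Pi.pow_apply, Pi.mul_apply, Pi.add_apply]
  field_simp
  norm_num
  ring

lemma hasDerivAt_tan_half (hβ : HasDerivAt β β' s) (hc : Real.cos (β s / 2) ≠ 0) :
    HasDerivAt (fun s => Real.tan (β s / 2)) ((1 + Real.tan (β s / 2) ^ 2) / 2 * β') s := by
  refine ((Real.hasDerivAt_tan hc).comp s (hβ.div_const 2)).congr_deriv ?_
  rw [← Real.inv_one_add_tan_sq hc]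
  field_simp

lemma hasDerivAt_capPressure (hρ : HasDerivAt ρ ρ' s) (hβ : HasDerivAt β β' s) (h0 : ρ s ≠ 0) :
    HasDerivAt (fun s => capPressure (ρ s) (β s))
      (-(1 - ρ s ^ 2) / ρ s ^ 2 * Real.sin (β s) * ρ' +
        (1 + ρ s ^ 2) / ρ s * Real.cos (β s) * β') s := by
  refine ((((hρ.pow 2).const_add 1).div hρ h0).mul
    ((Real.hasDerivAt_sin _).comp s hβ)).congr_deriv ?_
  simp only [Pi.pow_apply, Pi.div_apply, Function.comp]
  field_simp
  norm_num
  ring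

/-- Derivative of the volume of a cap along a curve; the second term is the same for all caps. -/
lemma hasDerivAt_capVolume {p' : ℝ} (hρ : HasDerivAt ρ ρ' s) (hβ : HasDerivAt β β' s)
    (hp : HasDerivAt (fun s => capPressure (ρ s) (β s)) p' s) (h0 : 0 < ρ s) (h1 : ρ s < 1)
    (hc : Real.cos (β s / 2) ≠ 0) (hu : (ρ s * Real.tan (β s / 2)) ^ 2 < 1) :
    HasDerivAt (fun s => capVolume (ρ s) (β s))
      (-capStiffness (ρ s) (Real.tan (β s / 2)) * p' +
        8 * Real.pi * ρ s ^ 3 / (1 - ρ s ^ 2) ^ 3 * β') s := by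
  have hr : ρ s ^ 2 < 1 := by nlinarith
  -- The rate `p'` is a free parameter because for a bubble it is known directly from the prescribed
  -- pressures. Here it is replaced by its expression in `ρ'` and `β'`.
  rw [hp.unique (hasDerivAt_capPressure hρ hβ h0.ne')]
  refine (hasDerivAt_lensVolume hρ (hρ.mul (hasDerivAt_tan_half hβ hc)) hr hu).congr_deriv ?_
  rw [sin_eq_tan_half hc, cos_eq_tan_half hc]
  simp only [Pi.mul_apply, capStiffness]
  generalize Real.tan (β s / 2) = τ at *
  have hr' : 1 - ρ s ^ 2 ≠ 0 := by linarith
  generalize ρ s = r at *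
  have hu' : 1 - (r * τ) ^ 2 ≠ 0 := by linarith
  have ht : 1 + τ ^ 2 ≠ 0 := by positivity
  rw [mul_pow] at *
  field_simp
  ring

/-- First variation of the area of a cap. -/
lemma hasDerivAt_capArea {p' : ℝ} (hρ : HasDerivAt ρ ρ' s) (hβ : HasDerivAt β β' s)
    (hp : HasDerivAt (fun s => capPressure (ρ s) (β s)) p' s) (h0 : 0 < ρ s) (h1 : ρ s < 1)
    (hc : Real.cos (β s / 2) ≠ 0) (hu : (ρ s * Real.tan (β s / 2)) ^ 2 < 1) :
    HasDerivAt (fun s => lensArea (ρ s) (ρ s * Real.tan (β s / 2)))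
      (capPressure (ρ s) (β s) * (-capStiffness (ρ s) (Real.tan (β s / 2)) * p' +
        8 * Real.pi * ρ s ^ 3 / (1 - ρ s ^ 2) ^ 3 * β') +
        Real.cos (β s) * (8 * Real.pi * ρ s / (1 - ρ s ^ 2) ^ 2 * ρ')) s := by
  have hr : ρ s ^ 2 < 1 := by nlinarith
  rw [hp.unique (hasDerivAt_capPressure hρ hβ h0.ne')]
  -- In the claimed formula the boundary term is `cos β` times the derivative of `4πρ² / (1 - ρ²)`,
  -- the area of the flat disc.
  refine (hasDerivAt_lensArea hρ (hρ.mul (hasDerivAt_tan_half hβ hc)) hr hu).congr_deriv ?_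
  rw [capPressure, sin_eq_tan_half hc, cos_eq_tan_half hc]
  simp only [Pi.mul_apply, capStiffness]
  generalize Real.tan (β s / 2) = τ at *
  have hr' : 1 - ρ s ^ 2 ≠ 0 := by linarith
  generalize ρ s = r at *
  have hu' : 1 - (r * τ) ^ 2 ≠ 0 := by linarith
  have ht : 1 + τ ^ 2 ≠ 0 := by positivity
  rw [mul_pow] at *
  field_simp
  ring

end

/-! ### Standard double bubbles in terms of the pressures of their outer caps -/

/-- The pairs of pressures of the outer caps of standard double bubbles. -/
def pressureDomain : Set (ℝ × ℝ) := {p | 2 < p.1 ∧ 2 < p.2}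

/-- `ρ + 1 / ρ` for the double bubble with outer pressures `p`. -/
noncomputable def bubbleK (p : ℝ × ℝ) : ℝ := √(4 / 3 * (p.1 ^ 2 + p.2 ^ 2 - p.1 * p.2))

/-- The Euclidean radius of the common boundary circle. -/
noncomputable def bubbleRho (p : ℝ × ℝ) : ℝ := (bubbleK p - √(bubbleK p ^ 2 - 4)) / 2

/-- The angle of the separating cap. -/
noncomputable def bubbleTheta (p : ℝ × ℝ) : ℝ :=
  Real.arctan (√3 * (p.2 - p.1) / (p.1 + p.2))

section
variable {p : ℝ × ℝ}

lemma bubbleK_sq (p : ℝ × ℝ) : bubbleK p ^ 2 = 4 / 3 * (p.1 ^ 2 + p.2 ^ 2 - p.1 * p.2) :=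
  Real.sq_sqrt (by nlinarith [sq_nonneg (p.1 - p.2), sq_nonneg (p.1 + p.2)])

lemma bubbleK_sq_ge (hp : p ∈ pressureDomain) : 16 / 3 < bubbleK p ^ 2 := by
  obtain ⟨h1, h2⟩ := hp
  rw [bubbleK_sq]
  nlinarith [sq_nonneg (p.1 - p.2)]

lemma two_lt_bubbleK (hp : p ∈ pressureDomain) : 2 < bubbleK p := by
  have := bubbleK_sq_ge hp
  have h0 : 0 ≤ bubbleK p := Real.sqrt_nonneg _
  nlinarith

/-- The radius is the smaller root of `ρ ^ 2 - k ρ + 1`; the other root is its inverse. -/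
lemma rho_of_k {k : ℝ} (hk : 2 < k) :
    0 < (k - √(k ^ 2 - 4)) / 2 ∧ (k - √(k ^ 2 - 4)) / 2 < 1 ∧
      (1 + ((k - √(k ^ 2 - 4)) / 2) ^ 2) / ((k - √(k ^ 2 - 4)) / 2) = k := by
  have h1 : 0 < k ^ 2 - 4 := by nlinarith
  have h2 := Real.sq_sqrt h1.le
  have h3 := Real.sqrt_pos.2 h1
  set q := √(k ^ 2 - 4)
  have h4 : q < k := by nlinarith
  have h5 : k - 2 < q := by nlinarith
  refine ⟨by linarith, by linarith, ?_⟩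
  rw [div_eq_iff (by linarith)]
  linear_combination (1 / 4) * h2

lemma rho_unique {k ρ : ℝ} (h0 : 0 < ρ) (h1 : ρ < 1) (hk : (1 + ρ ^ 2) / ρ = k) :
    (k - √(k ^ 2 - 4)) / 2 = ρ := by
  have h2 : k ^ 2 - 4 = ((1 - ρ ^ 2) / ρ) ^ 2 := by
    rw [← hk]; field_simp; ring
  have h3 : 0 < (1 - ρ ^ 2) / ρ := div_pos (by nlinarith) h0
  rw [h2, Real.sqrt_sq h3.le, ← hk]
  field_simp
  ring

lemma bubbleRho_pos (hp : p ∈ pressureDomain) : 0 < bubbleRho p := (rho_of_k (two_lt_bubbleK hp)).1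

lemma bubbleRho_lt_one (hp : p ∈ pressureDomain) : bubbleRho p < 1 :=
  (rho_of_k (two_lt_bubbleK hp)).2.1

lemma bubbleRho_eq (hp : p ∈ pressureDomain) : (1 + bubbleRho p ^ 2) / bubbleRho p = bubbleK p :=
  (rho_of_k (two_lt_bubbleK hp)).2.2

/-- From `k sin θ = p.2 - p.1` and `k cos θ = (p.1 + p.2) / √3` one reads off both `k ^ 2` and `tan
θ`. This root is the denominator in the sine and cosine of the arctangent. -/
lemma bubble_sqrt (hp : p ∈ pressureDomain) :
    √(1 + (√3 * (p.2 - p.1) / (p.1 + p.2)) ^ 2) = √3 * bubbleK p / (p.1 + p.2) := by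
  obtain ⟨h1, h2⟩ := hp
  have h3 : 0 < p.1 + p.2 := by linarith
  have h4 : 0 ≤ bubbleK p := Real.sqrt_nonneg _
  rw [Real.sqrt_eq_iff_mul_self_eq_of_pos (by
    have := two_lt_bubbleK ⟨h1, h2⟩
    positivity)]
  have h5 := bubbleK_sq p
  have h6 : √3 ^ 2 = (3 : ℝ) := Real.sq_sqrt (by norm_num)
  field_simp
  rw [h6, h5]
  ring

lemma bubbleK_mul_cos (hp : p ∈ pressureDomain) :
    bubbleK p * Real.cos (bubbleTheta p) = (p.1 + p.2) / √3 := by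
  have h1 := two_lt_bubbleK hp
  have h2 : 0 < p.1 + p.2 := by linarith [hp.1, hp.2]
  rw [bubbleTheta, Real.cos_arctan, bubble_sqrt hp]
  field_simp

lemma bubbleK_mul_sin (hp : p ∈ pressureDomain) :
    bubbleK p * Real.sin (bubbleTheta p) = p.2 - p.1 := by
  have h1 := two_lt_bubbleK hp
  have h2 : 0 < p.1 + p.2 := by linarith [hp.1, hp.2]
  rw [bubbleTheta, Real.sin_arctan, bubble_sqrt hp]
  field_simp

lemma abs_bubbleTheta_lt (hp : p ∈ pressureDomain) :
    -(Real.pi / 3) < bubbleTheta p ∧ bubbleTheta p < Real.pi / 3 := by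
  have h2 : 0 < p.1 + p.2 := by linarith [hp.1, hp.2]
  have h3 : 0 < √(3 : ℝ) := by positivity
  have h4 : Real.arctan √3 = Real.pi / 3 := by
    rw [← Real.tan_pi_div_three, Real.arctan_tan] <;> linarith [Real.pi_pos]
  rw [← h4, ← Real.arctan_neg]
  constructor <;> refine Real.arctan_strictMono ?_
  · rw [lt_div_iff₀ h2]; nlinarith [hp.1, hp.2]
  · rw [div_lt_iff₀ h2]; nlinarith [hp.1, hp.2]

lemma sin_add_two_pi_div_three (θ : ℝ) : Real.sin (θ + 2 * Real.pi / 3) =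
    -(1 / 2) * Real.sin θ + √3 / 2 * Real.cos θ := by
  rw [show θ + 2 * Real.pi / 3 = Real.pi - (Real.pi / 3 - θ) by ring, Real.sin_pi_sub, Real.sin_sub,
    Real.sin_pi_div_three, Real.cos_pi_div_three]
  ring

lemma cos_add_two_pi_div_three (θ : ℝ) : Real.cos (θ + 2 * Real.pi / 3) =
    -(1 / 2) * Real.cos θ - √3 / 2 * Real.sin θ := by
  rw [show θ + 2 * Real.pi / 3 = Real.pi - (Real.pi / 3 - θ) by ring, Real.cos_pi_sub, Real.cos_sub,
    Real.sin_pi_div_three, Real.cos_pi_div_three]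
  ring

lemma sin_two_pi_div_three_sub (θ : ℝ) : Real.sin (2 * Real.pi / 3 - θ) =
    1 / 2 * Real.sin θ + √3 / 2 * Real.cos θ := by
  have := sin_add_two_pi_div_three (-θ)
  rw [Real.sin_neg, Real.cos_neg] at this
  rw [show 2 * Real.pi / 3 - θ = -θ + 2 * Real.pi / 3 by ring, this]
  ring

lemma cos_two_pi_div_three_sub (θ : ℝ) : Real.cos (2 * Real.pi / 3 - θ) =
    -(1 / 2) * Real.cos θ + √3 / 2 * Real.sin θ := by
  have := cos_add_two_pi_div_three (-θ)
  rw [Real.sin_neg, Real.cos_neg] at this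
  rw [show 2 * Real.pi / 3 - θ = -θ + 2 * Real.pi / 3 by ring, this]
  ring

lemma capPressure_upper (hp : p ∈ pressureDomain) :
    capPressure (bubbleRho p) (bubbleTheta p + 2 * Real.pi / 3) = p.1 := by
  have h3 : √3 * √3 = (3 : ℝ) := Real.mul_self_sqrt (by norm_num)
  rw [capPressure, bubbleRho_eq hp, sin_add_two_pi_div_three]
  have h1 := bubbleK_mul_cos hp
  have h2 := bubbleK_mul_sin hp
  rw [eq_div_iff (by positivity)] at h1
  linear_combination -(1 / 2) * h2 + 1 / 2 * h1

lemma capPressure_lower (hp : p ∈ pressureDomain) :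
    capPressure (bubbleRho p) (2 * Real.pi / 3 - bubbleTheta p) = p.2 := by
  rw [capPressure, bubbleRho_eq hp, sin_two_pi_div_three_sub]
  have h1 := bubbleK_mul_cos hp
  have h2 := bubbleK_mul_sin hp
  rw [eq_div_iff (by positivity)] at h1
  linear_combination 1 / 2 * h2 + 1 / 2 * h1

lemma capPressure_middle (hp : p ∈ pressureDomain) :
    capPressure (bubbleRho p) (bubbleTheta p) = p.2 - p.1 := by
  rw [capPressure, bubbleRho_eq hp, bubbleK_mul_sin hp]

/-- A cap of pressure more than two lies strictly inside hyperbolic space. -/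
lemma apex_of_two_lt_capPressure {ρ β : ℝ} (h0 : 0 < ρ) (h1 : ρ < 1) (hβ : 0 < β)
    (hβ' : β < Real.pi) (h : 2 < capPressure ρ β) :
    ρ < Real.tan (β / 2) ∧ ρ * Real.tan (β / 2) < 1 := by
  have hτ := tan_half_pos hβ hβ'
  rw [capPressure, sin_eq_tan_half (cos_half_pos (by linarith) hβ').ne'] at h
  generalize Real.tan (β / 2) = τ at *
  -- The excess of the pressure over the horosphere value `2` factors through the positions of the
  -- two poles `ρ * τ` and `-ρ / τ`. Both factors cannot be negative, since `τ < ρ < 1` forces `ρ *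
  -- τ < 1`.
  have h2 : 0 < (τ - ρ) * (1 - ρ * τ) := by
    have h3 : (1 + ρ ^ 2) / ρ * (2 * τ / (1 + τ ^ 2)) =
      2 + 2 * ((τ - ρ) * (1 - ρ * τ)) / (ρ * (1 + τ ^ 2)) := by field_simp; ring
    rw [h3] at h
    have h4 : 0 < 2 * ((τ - ρ) * (1 - ρ * τ)) / (ρ * (1 + τ ^ 2)) := by linarith
    have h5 : 0 < ρ * (1 + τ ^ 2) := by positivity
    have := (div_pos_iff_of_pos_right h5).1 h4
    linarith
  rcases pos_and_pos_or_neg_and_neg_of_mul_pos h2 with ⟨h3, h4⟩ | ⟨h3, h4⟩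
  · exact ⟨by linarith, by linarith⟩
  · nlinarith

lemma two_lt_capPressure_of_apex {ρ β : ℝ} (h0 : 0 < ρ) (hβ : 0 < β)
    (hβ' : β < Real.pi) (h2 : ρ < Real.tan (β / 2)) (h3 : ρ * Real.tan (β / 2) < 1) :
    2 < capPressure ρ β := by
  rw [capPressure, sin_eq_tan_half (cos_half_pos (by linarith) hβ').ne']
  generalize Real.tan (β / 2) = τ at *
  have h4 : (1 + ρ ^ 2) / ρ * (2 * τ / (1 + τ ^ 2)) =
      2 + 2 * ((τ - ρ) * (1 - ρ * τ)) / (ρ * (1 + τ ^ 2)) := by field_simp; ring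
  have h5 : 0 < 2 * ((τ - ρ) * (1 - ρ * τ)) / (ρ * (1 + τ ^ 2)) :=
    div_pos (by nlinarith [mul_pos (sub_pos.2 h2) (sub_pos.2 h3)]) (by positivity)
  linarith

/-- The sphere of an outer cap is contained in hyperbolic space iff its pressure exceeds two. -/
lemma pencil_subset_iff {ρ β : ℝ} (h0 : 0 < ρ) (hβ : 0 < β) (hβ' : β < Real.pi) :
    {p | pencil ρ β p = 0} ⊆ hypSpace ↔ ρ < 1 ∧ 2 < capPressure ρ β := by
  have hτ := tan_half_pos hβ hβ'
  have hc := (cos_half_pos (by linarith) hβ').ne'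
  have hs := Real.sin_pos_of_pos_of_lt_pi hβ hβ'
  constructor
  · intro h
    -- Three points of the sphere suffice: the two poles on the axis and a point of the rim.
    have ht := @h (0, 0, ρ * Real.tan (β / 2)) (by
      simp only [mem_ofPred_eq, pencil_eq hc hτ.ne']; ring)
    have hb := @h (0, 0, -(ρ / Real.tan (β / 2))) (by
      simp only [mem_ofPred_eq, pencil_eq hc hτ.ne']; ring)
    have he := @h (ρ, 0, 0) (by
      simp only [mem_ofPred_eq, pencil_eq hc hτ.ne']; field_simp; ring)
    simp only [hypSpace, normSq, mem_ofPred_eq] at ht hb he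
    have hρ : ρ < 1 := by nlinarith
    have h1 : ρ * Real.tan (β / 2) < 1 := by nlinarith [mul_pos h0 hτ]
    have h2 : ρ / Real.tan (β / 2) < 1 := by nlinarith [div_pos h0 hτ]
    exact ⟨hρ, two_lt_capPressure_of_apex h0 hβ hβ' ((div_lt_one hτ).1 h2) h1⟩
  · rintro ⟨hρ, h⟩ ⟨x, y, z⟩ hp
    obtain ⟨h1, h2⟩ := apex_of_two_lt_capPressure h0 hρ hβ hβ' h
    simp only [mem_ofPred_eq, pencil_eq hc hτ.ne', mul_eq_zero, hs.ne', false_or] at hp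
    simp only [hypSpace, normSq, mem_ofPred_eq]
    generalize Real.tan (β / 2) = τ at *
    have h3 : ρ / τ < 1 := (div_lt_one hτ).2 h1
    have h4 : 0 < ρ / τ := by positivity
    have h5 : 0 < ρ * τ := by positivity
    generalize ρ * τ = u at *
    generalize ρ / τ = v at *
    have h6 : 0 ≤ (u - z) * (z + v) := by nlinarith [sq_nonneg x, sq_nonneg y]
    have h7 : z ≤ u := by
      by_contra! hcon
      nlinarith [mul_pos (sub_pos.2 hcon) (by linarith : 0 < z + v)]
    have h8 : -v ≤ z := by
      by_contra! hcon
      nlinarith [mul_pos (sub_pos.2 hcon) (by linarith : 0 < u - z)]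
    nlinarith

lemma isStandardDoubleBubble_iff {ρ θ : ℝ} : IsStandardDoubleBubble ρ θ ↔
    0 < ρ ∧ ρ < 1 ∧ -(Real.pi / 3) < θ ∧ θ < Real.pi / 3 ∧
      2 < capPressure ρ (θ + 2 * Real.pi / 3) ∧ 2 < capPressure ρ (2 * Real.pi / 3 - θ) := by
  have hmir : ∀ ρ β : ℝ, {p | pencil ρ (-β) p = 0} ⊆ hypSpace ↔
      {p | pencil ρ β p = 0} ⊆ hypSpace := by
    have key : ∀ ρ β : ℝ, {p | pencil ρ (-β) p = 0} ⊆ hypSpace →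
      {p | pencil ρ β p = 0} ⊆ hypSpace := by
      intro ρ β h p hp
      have h1 := @h (mirror p) (by
        simp only [mem_ofPred_eq, pencil_mirror, neg_neg] at hp ⊢
        rw [hp, neg_zero])
      simpa [hypSpace, normSq, mirror] using h1
    exact fun ρ β => ⟨key ρ β, fun h => key ρ (-β) (by rwa [neg_neg])⟩
  rw [IsStandardDoubleBubble, show θ - 2 * Real.pi / 3 = -(2 * Real.pi / 3 - θ) by ring, hmir]
  constructor
  · rintro ⟨h0, h1, h2, h3, h4⟩
    have h5 := (pencil_subset_iff h0 (by linarith) (by linarith)).1 h3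
    have h6 := (pencil_subset_iff h0 (by linarith) (by linarith)).1 h4
    exact ⟨h0, h5.1, h1, h2, h5.2, h6.2⟩
  · rintro ⟨h0, h5, h1, h2, h3, h4⟩
    exact ⟨h0, h1, h2, (pencil_subset_iff h0 (by linarith) (by linarith)).2 ⟨h5, h3⟩,
      (pencil_subset_iff h0 (by linarith) (by linarith)).2 ⟨h5, h4⟩⟩

lemma isStandardDoubleBubble_of_mem (hp : p ∈ pressureDomain) :
    IsStandardDoubleBubble (bubbleRho p) (bubbleTheta p) := by
  rw [isStandardDoubleBubble_iff, capPressure_upper hp, capPressure_lower hp]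
  exact ⟨bubbleRho_pos hp, bubbleRho_lt_one hp, (abs_bubbleTheta_lt hp).1,
    (abs_bubbleTheta_lt hp).2, hp.1, hp.2⟩

lemma exists_pressures_of_isStandardDoubleBubble {ρ θ : ℝ} (h : IsStandardDoubleBubble ρ θ) :
    ∃ p ∈ pressureDomain, bubbleRho p = ρ ∧ bubbleTheta p = θ := by
  rw [isStandardDoubleBubble_iff] at h
  obtain ⟨h0, h1, h2, h3, h4, h5⟩ := h
  refine ⟨(capPressure ρ (θ + 2 * Real.pi / 3), capPressure ρ (2 * Real.pi / 3 - θ)),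
    ⟨h4, h5⟩, ?_, ?_⟩
  · refine rho_unique h0 h1 ?_
    have hk : 0 < (1 + ρ ^ 2) / ρ := by positivity
    rw [bubbleK, eq_comm, Real.sqrt_eq_iff_mul_self_eq_of_pos hk]
    simp only [capPressure, sin_add_two_pi_div_three, sin_two_pi_div_three_sub]
    have h6 : √3 ^ 2 = (3 : ℝ) := Real.sq_sqrt (by norm_num)
    have h7 := Real.sin_sq_add_cos_sq θ
    generalize (1 + ρ ^ 2) / ρ = k
    linear_combination (-k ^ 2) * h7 - (1 / 3) * k ^ 2 * Real.cos θ ^ 2 * h6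
  · have hc : 0 < Real.cos θ := Real.cos_pos_of_mem_Ioo ⟨by linarith, by linarith⟩
    have hk : 0 < (1 + ρ ^ 2) / ρ := by positivity
    have h8 : √3 * (capPressure ρ (2 * Real.pi / 3 - θ) - capPressure ρ (θ + 2 * Real.pi / 3)) /
        (capPressure ρ (θ + 2 * Real.pi / 3) + capPressure ρ (2 * Real.pi / 3 - θ)) =
        Real.tan θ := by
      simp only [capPressure, sin_add_two_pi_div_three, sin_two_pi_div_three_sub,
        Real.tan_eq_sin_div_cos]
      generalize (1 + ρ ^ 2) / ρ = k at *
      have h9 : k * (-(1 / 2) * Real.sin θ + √3 / 2 * Real.cos θ) +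
        k * (1 / 2 * Real.sin θ + √3 / 2 * Real.cos θ) = k * √3 * Real.cos θ := by ring
      rw [h9]
      field_simp
      ring
    rw [bubbleTheta, h8, Real.arctan_tan] <;> linarith

end

/-! ### Volumes and area as smooth functions of the pressures -/

/-- Volume of the upper region of the double bubble with outer pressures `p`. -/
noncomputable def upperVolume (p : ℝ × ℝ) : ℝ :=
  capVolume (bubbleRho p) (bubbleTheta p + 2 * Real.pi / 3) -
    capVolume (bubbleRho p) (bubbleTheta p)

/-- Volume of the lower region of the double bubble with outer pressures `p`. -/
noncomputable def lowerVolume (p : ℝ × ℝ) : ℝ :=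
  capVolume (bubbleRho p) (2 * Real.pi / 3 - bubbleTheta p) +
    capVolume (bubbleRho p) (bubbleTheta p)

/-- Total area of the double bubble with outer pressures `p`. -/
noncomputable def bubbleArea (p : ℝ × ℝ) : ℝ :=
  lensArea (bubbleRho p) (bubbleRho p * Real.tan ((bubbleTheta p + 2 * Real.pi / 3) / 2)) +
    lensArea (bubbleRho p) (bubbleRho p * Real.tan (bubbleTheta p / 2)) +
    lensArea (bubbleRho p) (bubbleRho p * Real.tan ((2 * Real.pi / 3 - bubbleTheta p) / 2))

lemma isOpen_pressureDomain : IsOpen pressureDomain :=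
  (isOpen_lt continuous_const continuous_fst).inter (isOpen_lt continuous_const continuous_snd)

lemma convex_pressureDomain : Convex ℝ pressureDomain := by
  have : pressureDomain = Ioi 2 ×ˢ Ioi 2 := by ext; simp [pressureDomain]
  rw [this]
  exact (convex_Ioi 2).prod (convex_Ioi 2)

section
variable {p : ℝ × ℝ}

lemma upper_apex (hp : p ∈ pressureDomain) :
    bubbleRho p < Real.tan ((bubbleTheta p + 2 * Real.pi / 3) / 2) ∧
      bubbleRho p * Real.tan ((bubbleTheta p + 2 * Real.pi / 3) / 2) < 1 := by
  have h := abs_bubbleTheta_lt hp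
  exact apex_of_two_lt_capPressure (bubbleRho_pos hp) (bubbleRho_lt_one hp) (by linarith)
    (by linarith) (by rw [capPressure_upper hp]; exact hp.1)

lemma lower_apex (hp : p ∈ pressureDomain) :
    bubbleRho p < Real.tan ((2 * Real.pi / 3 - bubbleTheta p) / 2) ∧
      bubbleRho p * Real.tan ((2 * Real.pi / 3 - bubbleTheta p) / 2) < 1 := by
  have h := abs_bubbleTheta_lt hp
  exact apex_of_two_lt_capPressure (bubbleRho_pos hp) (bubbleRho_lt_one hp) (by linarith)
    (by linarith) (by rw [capPressure_lower hp]; exact hp.2)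

lemma upper_apex_sq (hp : p ∈ pressureDomain) :
    (bubbleRho p * Real.tan ((bubbleTheta p + 2 * Real.pi / 3) / 2)) ^ 2 < 1 := by
  have h := upper_apex hp
  have h0 := bubbleRho_pos hp
  rw [sq_lt_one_iff₀ (mul_pos h0 (h0.trans h.1)).le]
  exact h.2

lemma lower_apex_sq (hp : p ∈ pressureDomain) :
    (bubbleRho p * Real.tan ((2 * Real.pi / 3 - bubbleTheta p) / 2)) ^ 2 < 1 := by
  have h := lower_apex hp
  have h0 := bubbleRho_pos hp
  rw [sq_lt_one_iff₀ (mul_pos h0 (h0.trans h.1)).le]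
  exact h.2

lemma abs_tan_middle_lt (hp : p ∈ pressureDomain) : |Real.tan (bubbleTheta p / 2)| < 1 := by
  have h := abs_bubbleTheta_lt hp
  rw [abs_lt]
  have h1 : Real.tan (Real.pi / 4) = 1 := Real.tan_pi_div_four
  constructor
  · rw [← h1, ← Real.tan_neg]
    refine Real.tan_lt_tan_of_lt_of_lt_pi_div_two ?_ ?_ ?_ <;> linarith
  · rw [← h1]
    refine Real.tan_lt_tan_of_lt_of_lt_pi_div_two ?_ ?_ ?_ <;> linarith

lemma middle_apex_sq (hp : p ∈ pressureDomain) :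
    (bubbleRho p * Real.tan (bubbleTheta p / 2)) ^ 2 < 1 := by
  have h1 := (sq_lt_one_iff_abs_lt_one _).2 (abs_tan_middle_lt hp)
  have h2 : bubbleRho p ^ 2 < 1 := (sq_lt_one_iff₀ (bubbleRho_pos hp).le).2 (bubbleRho_lt_one hp)
  rw [mul_pow]
  nlinarith [sq_nonneg (bubbleRho p)]

lemma upper_cos_ne (hp : p ∈ pressureDomain) :
    Real.cos ((bubbleTheta p + 2 * Real.pi / 3) / 2) ≠ 0 := by
  have h := abs_bubbleTheta_lt hp
  exact (cos_half_pos (by linarith) (by linarith)).ne'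

lemma lower_cos_ne (hp : p ∈ pressureDomain) :
    Real.cos ((2 * Real.pi / 3 - bubbleTheta p) / 2) ≠ 0 := by
  have h := abs_bubbleTheta_lt hp
  exact (cos_half_pos (by linarith) (by linarith)).ne'

lemma middle_cos_ne (hp : p ∈ pressureDomain) : Real.cos (bubbleTheta p / 2) ≠ 0 := by
  have h := abs_bubbleTheta_lt hp
  exact (cos_half_pos (by linarith) (by linarith)).ne'

/-- Continuous differentiability, rather than mere differentiability, is what supplies the strict
derivative for the inverse function theorem. -/
lemma contDiffAt_bubbleK (hp : p ∈ pressureDomain) : ContDiffAt ℝ 1 bubbleK p := by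
  have h := bubbleK_sq_ge hp
  rw [bubbleK_sq] at h
  exact ContDiffAt.sqrt (by fun_prop) (by linarith)

lemma contDiffAt_bubbleRho (hp : p ∈ pressureDomain) : ContDiffAt ℝ 1 bubbleRho p := by
  have h := bubbleK_sq_ge hp
  have hk := contDiffAt_bubbleK hp
  exact (hk.sub (((hk.pow 2).sub contDiffAt_const).sqrt (by linarith))).div_const 2

lemma contDiffAt_bubbleTheta (hp : p ∈ pressureDomain) : ContDiffAt ℝ 1 bubbleTheta p := by
  have h : p.1 + p.2 ≠ 0 := by have := hp.1; have := hp.2; linarith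
  exact ContDiffAt.arctan (ContDiffAt.div (by fun_prop) (by fun_prop) h)

lemma contDiffAt_lensVolume {r u : ℝ × ℝ → ℝ} (hr : ContDiffAt ℝ 1 r p) (hu : ContDiffAt ℝ 1 u p)
    (h1 : r p ^ 2 < 1) (h2 : u p ^ 2 < 1) :
    ContDiffAt ℝ 1 (fun p => lensVolume (r p) (u p)) p := by
  have hb := abs_lt.1 ((sq_lt_one_iff_abs_lt_one _).1 h2)
  unfold lensVolume
  have hd : (1 - r p ^ 2) * (1 - u p ^ 2) ≠ 0 := mul_ne_zero (by linarith) (by linarith)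
  have hq : ContDiffAt ℝ 1
      (fun p => u p * (1 + r p ^ 2) / ((1 - r p ^ 2) * (1 - u p ^ 2))) p :=
    ContDiffAt.div (by fun_prop) (by fun_prop) hd
  have hl1 : ContDiffAt ℝ 1 (fun p => Real.log (1 + u p)) p :=
    ContDiffAt.log (by fun_prop) (by linarith)
  have hl2 : ContDiffAt ℝ 1 (fun p => Real.log (1 - u p)) p :=
    ContDiffAt.log (by fun_prop) (by linarith)
  exact (contDiffAt_const.mul hq).sub (contDiffAt_const.mul (hl1.sub hl2))

lemma bubbleRho_sq_lt_one (hp : p ∈ pressureDomain) : bubbleRho p ^ 2 < 1 :=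
  (sq_lt_one_iff₀ (bubbleRho_pos hp).le).2 (bubbleRho_lt_one hp)

lemma contDiffAt_tan {f : ℝ × ℝ → ℝ} (hf : ContDiffAt ℝ 1 f p) (h : Real.cos (f p) ≠ 0) :
    ContDiffAt ℝ 1 (fun p => Real.tan (f p)) p :=
  (Real.contDiffAt_tan.2 h).comp p hf

lemma contDiffAt_upperVolume (hp : p ∈ pressureDomain) : ContDiffAt ℝ 1 upperVolume p := by
  have hr := contDiffAt_bubbleRho hp
  have ht := contDiffAt_bubbleTheta hp
  have h1 := contDiffAt_tan ((ht.add (contDiffAt_const (c := 2 * Real.pi / 3))).div_const 2)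
    (upper_cos_ne hp)
  have h3 := contDiffAt_tan (ht.div_const 2) (middle_cos_ne hp)
  exact (contDiffAt_lensVolume hr (hr.mul h1) (bubbleRho_sq_lt_one hp) (upper_apex_sq hp)).sub
    (contDiffAt_lensVolume hr (hr.mul h3) (bubbleRho_sq_lt_one hp) (middle_apex_sq hp))

lemma contDiffAt_lowerVolume (hp : p ∈ pressureDomain) : ContDiffAt ℝ 1 lowerVolume p := by
  have hr := contDiffAt_bubbleRho hp
  have ht := contDiffAt_bubbleTheta hp
  have h2 := contDiffAt_tan (((contDiffAt_const (c := 2 * Real.pi / 3)).sub ht).div_const 2)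
    (lower_cos_ne hp)
  have h3 := contDiffAt_tan (ht.div_const 2) (middle_cos_ne hp)
  exact (contDiffAt_lensVolume hr (hr.mul h2) (bubbleRho_sq_lt_one hp) (lower_apex_sq hp)).add
    (contDiffAt_lensVolume hr (hr.mul h3) (bubbleRho_sq_lt_one hp) (middle_apex_sq hp))

end

/-! ### First variation, uniqueness and existence of double bubbles -/

/-- First variation of the volumes and the area along a curve of double bubbles. -/
theorem hasDerivAt_along_curve {γ : ℝ → ℝ × ℝ} {h : ℝ × ℝ} {s : ℝ} (hγ : HasDerivAt γ h s)
    (hs : γ s ∈ pressureDomain) : ∃ g₁ g₂ g₃ : ℝ, 0 < g₁ ∧ 0 < g₂ ∧ 0 < g₃ ∧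
      HasDerivAt (fun s => upperVolume (γ s)) (-g₁ * h.1 + g₃ * (h.2 - h.1)) s ∧
      HasDerivAt (fun s => lowerVolume (γ s)) (-g₂ * h.2 - g₃ * (h.2 - h.1)) s ∧
      HasDerivAt (fun s => bubbleArea (γ s)) ((γ s).1 * (-g₁ * h.1 + g₃ * (h.2 - h.1)) +
        (γ s).2 * (-g₂ * h.2 - g₃ * (h.2 - h.1))) s := by
  have hev : ∀ᶠ t in nhds s, γ t ∈ pressureDomain :=
    hγ.continuousAt.eventually_mem (isOpen_pressureDomain.mem_nhds hs)
  have hρ : HasDerivAt (fun t => bubbleRho (γ t)) (fderiv ℝ bubbleRho (γ s) h) s :=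
    ((contDiffAt_bubbleRho hs).differentiableAt one_ne_zero).hasFDerivAt.comp_hasDerivAt s hγ
  have hθ : HasDerivAt (fun t => bubbleTheta (γ t)) (fderiv ℝ bubbleTheta (γ s) h) s :=
    ((contDiffAt_bubbleTheta hs).differentiableAt one_ne_zero).hasFDerivAt.comp_hasDerivAt s hγ
  generalize fderiv ℝ bubbleRho (γ s) h = ρ' at hρ
  generalize fderiv ℝ bubbleTheta (γ s) h = θ' at hθ
  have hγ1 : HasDerivAt (fun t => (γ t).1) h.1 s := (ContinuousLinearMap.fst ℝ ℝ ℝ).hasFDerivAt.comp_hasDerivAt s hγ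
  have hγ2 : HasDerivAt (fun t => (γ t).2) h.2 s := (ContinuousLinearMap.snd ℝ ℝ ℝ).hasFDerivAt.comp_hasDerivAt s hγ
  -- The pressures of the caps are the coordinates of the curve, and for the separating cap their
  -- difference, as long as the curve stays in the open domain.
  have hp1 := hγ1.congr_of_eventuallyEq (hev.mono fun t ht => capPressure_upper ht)
  have hp2 := hγ2.congr_of_eventuallyEq (hev.mono fun t ht => capPressure_lower ht)
  have hp3 := (hγ2.sub hγ1).congr_of_eventuallyEq (hev.mono fun t ht => capPressure_middle ht)
  have h0 := bubbleRho_pos hs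
  have h1 := bubbleRho_lt_one hs
  have hb1 := hθ.add_const (2 * Real.pi / 3)
  have hb2 := hθ.const_sub (2 * Real.pi / 3)
  have v1 := hasDerivAt_capVolume hρ hb1 hp1 h0 h1 (upper_cos_ne hs) (upper_apex_sq hs)
  have v2 := hasDerivAt_capVolume hρ hb2 hp2 h0 h1 (lower_cos_ne hs) (lower_apex_sq hs)
  have v3 := hasDerivAt_capVolume hρ hθ hp3 h0 h1 (middle_cos_ne hs) (middle_apex_sq hs)
  have a1 := hasDerivAt_capArea hρ hb1 hp1 h0 h1 (upper_cos_ne hs) (upper_apex_sq hs)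
  have a2 := hasDerivAt_capArea hρ hb2 hp2 h0 h1 (lower_cos_ne hs) (lower_apex_sq hs)
  have a3 := hasDerivAt_capArea hρ hθ hp3 h0 h1 (middle_cos_ne hs) (middle_apex_sq hs)
  refine ⟨_, _, _, capStiffness_pos h0 h1 (upper_apex_sq hs),
    capStiffness_pos h0 h1 (lower_apex_sq hs), capStiffness_pos h0 h1 (middle_apex_sq hs),
    (v1.sub v3).congr_deriv ?_, (v2.add v3).congr_deriv ?_, ((a1.add a3).add a2).congr_deriv ?_⟩
  · ring
  · ring
  -- The boundary terms add up to zero because the cosines of three angles at 120 degrees do. This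
  -- is the balance of forces along the common circle.
  · rw [capPressure_upper hs, capPressure_lower hs, capPressure_middle hs,
      cos_add_two_pi_div_three, cos_two_pi_div_three_sub]
    ring

/-- The volumes determine the double bubble. -/
theorem eq_of_volumes_eq {p q : ℝ × ℝ} (hp : p ∈ pressureDomain) (hq : q ∈ pressureDomain)
    (h1 : upperVolume p = upperVolume q) (h2 : lowerVolume p = lowerVolume q) : p = q := by
  by_contra hne
  set h : ℝ × ℝ := q - p with hh
  have hmem : ∀ s ∈ Icc (0 : ℝ) 1, p + s • h ∈ pressureDomain := fun s hs =>
    convex_pressureDomain.add_smul_sub_mem hp hq hs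
  have hγ : ∀ s : ℝ, HasDerivAt (fun s : ℝ => p + s • h) h s := fun s => by
    simpa using ((hasDerivAt_id s).smul_const h).const_add p
  -- The volume vector paired with the direction `h`. Its derivative along the segment is `-(g₁ h.1²
  -- + g₂ h.2² + g₃ (h.2 - h.1)²) < 0`, so its values at the two ends differ.
  let f : ℝ → ℝ := fun s => h.1 * upperVolume (p + s • h) + h.2 * lowerVolume (p + s • h)
  have hf : ∀ s ∈ Icc (0 : ℝ) 1, ∃ f' < 0, HasDerivAt f f' s := by
    intro s hs
    obtain ⟨g₁, g₂, g₃, hg1, hg2, hg3, hv, hw, -⟩ := hasDerivAt_along_curve (hγ s) (hmem s hs)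
    refine ⟨_, ?_, (hv.const_mul h.1).add (hw.const_mul h.2)⟩
    have hpos : 0 < g₁ * h.1 ^ 2 + g₂ * h.2 ^ 2 := by
      by_cases h3 : h.1 = 0
      · have h4 : h.2 ≠ 0 := fun h4 => hne (sub_eq_zero.1 (Prod.ext h3 h4 : q - p = 0)).symm
        positivity
      · positivity
    nlinarith [mul_nonneg hg3.le (sq_nonneg (h.2 - h.1))]
  have hcont : ContinuousOn f (Icc 0 1) := fun s hs => by
    obtain ⟨f', -, hf'⟩ := hf s hs
    exact hf'.continuousAt.continuousWithinAt
  have hanti : StrictAntiOn f (Icc 0 1) := by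
    refine strictAntiOn_of_deriv_neg (convex_Icc 0 1) hcont fun s hs => ?_
    rw [interior_Icc] at hs
    obtain ⟨f', hneg, hf'⟩ := hf s (Ioo_subset_Icc_self hs)
    rw [hf'.deriv]
    exact hneg
  have h3 := hanti (left_mem_Icc.2 zero_le_one) (right_mem_Icc.2 zero_le_one) zero_lt_one
  have h4 : p + h = q := by rw [hh]; abel
  simp only [f, one_smul, zero_smul, add_zero, h4, h1, h2, lt_self_iff_false] at h3

/-- `ENNReal.ofReal` collapses nonpositive numbers to zero; positivity of `v` excludes this case. -/
lemma eq_of_ofReal_eq {x v : ℝ} (hv : 0 < v) (h : ENNReal.ofReal x = ENNReal.ofReal v) : x = v := by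
  have hx : 0 < x := by
    by_contra! hx
    rw [ENNReal.ofReal_of_nonpos hx, eq_comm, ENNReal.ofReal_eq_zero] at h
    linarith
  exact (ENNReal.ofReal_eq_ofReal_iff hx.le hv.le).1 h

section
variable {p : ℝ × ℝ}

lemma hypVolume_upperRegion_bubble (hp : p ∈ pressureDomain) :
    hypVolume (upperRegion (bubbleRho p) (bubbleTheta p)) = ENNReal.ofReal (upperVolume p) :=
  hypVolume_upperRegion (bubbleRho_pos hp) (bubbleRho_lt_one hp) (abs_bubbleTheta_lt hp).1
    (abs_bubbleTheta_lt hp).2 (upper_apex hp).2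

lemma hypVolume_lowerRegion_bubble (hp : p ∈ pressureDomain) :
    hypVolume (lowerRegion (bubbleRho p) (bubbleTheta p)) = ENNReal.ofReal (lowerVolume p) :=
  hypVolume_lowerRegion (bubbleRho_pos hp) (bubbleRho_lt_one hp) (abs_bubbleTheta_lt hp).1
    (abs_bubbleTheta_lt hp).2 (lower_apex hp).2

lemma doubleBubbleTotalArea_bubble (hp : p ∈ pressureDomain) :
    doubleBubbleTotalArea (bubbleRho p) (bubbleTheta p) = bubbleArea p := by
  have h : Real.tan ((bubbleTheta p - 2 * Real.pi / 3) / 2) =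
      -Real.tan ((2 * Real.pi / 3 - bubbleTheta p) / 2) := by
    rw [← Real.tan_neg]; ring_nf
  have h' : (bubbleRho p * Real.tan ((bubbleTheta p - 2 * Real.pi / 3) / 2)) ^ 2 =
      (bubbleRho p * Real.tan ((2 * Real.pi / 3 - bubbleTheta p) / 2)) ^ 2 := by
    rw [h, mul_neg, neg_sq]
  rw [doubleBubbleTotalArea, bubbleArea,
    capArea_eq (bubbleRho_pos hp) (bubbleRho_lt_one hp) (upper_apex_sq hp),
    capArea_eq (bubbleRho_pos hp) (bubbleRho_lt_one hp) (middle_apex_sq hp),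
    capArea_eq (bubbleRho_pos hp) (bubbleRho_lt_one hp) (h' ▸ lower_apex_sq hp), h']
  rfl

end

lemma isDoubleBubbleArea_iff {v w a : ℝ} (hv : 0 < v) (hw : 0 < w) :
    IsDoubleBubbleArea v w a ↔
      ∃ p ∈ pressureDomain, upperVolume p = v ∧ lowerVolume p = w ∧ a = bubbleArea p := by
  constructor
  · rintro ⟨ρ, θ, h, h1, h2, h3⟩
    obtain ⟨p, hp, rfl, rfl⟩ := exists_pressures_of_isStandardDoubleBubble h
    rw [hypVolume_upperRegion_bubble hp] at h1
    rw [hypVolume_lowerRegion_bubble hp] at h2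
    exact ⟨p, hp, eq_of_ofReal_eq hv h1, eq_of_ofReal_eq hw h2,
      h3.trans (doubleBubbleTotalArea_bubble hp)⟩
  · rintro ⟨p, hp, h1, h2, h3⟩
    exact ⟨bubbleRho p, bubbleTheta p, isStandardDoubleBubble_of_mem hp,
      by rw [hypVolume_upperRegion_bubble hp, h1], by rw [hypVolume_lowerRegion_bubble hp, h2],
      by rw [doubleBubbleTotalArea_bubble hp, h3]⟩

lemma isDoubleBubbleArea_iff_eq {p : ℝ × ℝ} (hp : p ∈ pressureDomain) (hv : 0 < upperVolume p)
    (hw : 0 < lowerVolume p) {a : ℝ} :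
    IsDoubleBubbleArea (upperVolume p) (lowerVolume p) a ↔ a = bubbleArea p := by
  rw [isDoubleBubbleArea_iff hv hw]
  constructor
  · rintro ⟨q, hq, h1, h2, h3⟩
    rw [h3, eq_of_volumes_eq hq hp h1 h2]
  · rintro h
    exact ⟨p, hp, rfl, rfl, h⟩

lemma doubleBubbleArea_eq {p : ℝ × ℝ} (hp : p ∈ pressureDomain) (hv : 0 < upperVolume p)
    (hw : 0 < lowerVolume p) :
    doubleBubbleArea (upperVolume p) (lowerVolume p) = bubbleArea p := by
  simp only [doubleBubbleArea, isDoubleBubbleArea_iff_eq hp hv hw]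
  exact csInf_singleton _

lemma contDiffAt_bubbleArea {p : ℝ × ℝ} (hp : p ∈ pressureDomain) :
    ContDiffAt ℝ 1 bubbleArea p := by
  have hr := contDiffAt_bubbleRho hp
  have ht := contDiffAt_bubbleTheta hp
  have h1 := contDiffAt_tan ((ht.add (contDiffAt_const (c := 2 * Real.pi / 3))).div_const 2)
    (upper_cos_ne hp)
  have h2 := contDiffAt_tan (((contDiffAt_const (c := 2 * Real.pi / 3)).sub ht).div_const 2)
    (lower_cos_ne hp)
  have h3 := contDiffAt_tan (ht.div_const 2) (middle_cos_ne hp)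
  have key : ∀ u : ℝ × ℝ → ℝ, ContDiffAt ℝ 1 u p → u p ^ 2 < 1 →
      ContDiffAt ℝ 1 (fun p => lensArea (bubbleRho p) (u p)) p := by
    intro u hu hu1
    have hd : (1 - bubbleRho p ^ 2) * (1 - u p ^ 2) ≠ 0 :=
      mul_ne_zero (by linarith [bubbleRho_sq_lt_one hp]) (by linarith)
    have hq : ContDiffAt ℝ 1 (fun p => (bubbleRho p ^ 2 + u p ^ 2) /
        ((1 - bubbleRho p ^ 2) * (1 - u p ^ 2))) p :=
      ContDiffAt.div (by fun_prop) (by fun_prop) hd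
    exact contDiffAt_const.mul hq
  exact ((key _ (hr.mul h1) (upper_apex_sq hp)).add (key _ (hr.mul h3) (middle_apex_sq hp))).add
    (key _ (hr.mul h2) (lower_apex_sq hp))

lemma nonneg_of_hasDerivAt_of_right {f : ℝ → ℝ} {f' : ℝ} (hf : HasDerivAt f f' 0)
    (h : ∀ᶠ s in nhdsWithin 0 (Ioi 0), f 0 ≤ f s) : 0 ≤ f' := by
  have ht := (hasDerivWithinAt_iff_tendsto_slope' (notMem_Ioi.2 le_rfl)).1
    (hf.hasDerivWithinAt (s := Ioi 0))
  refine ge_of_tendsto ht ?_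
  filter_upwards [h, self_mem_nhdsWithin] with s hs hs0
  rw [slope_def_field]
  exact div_nonneg (by linarith) (by simpa using (mem_Ioi.1 hs0).le)

/-- Existence of double bubbles by minimizing the Legendre transform of the area over a box. -/
theorem exists_bubble_of_box {v w lo hi : ℝ} (h2 : 2 < lo) (hlh : lo < hi)
    (hv1 : ∀ y ∈ Icc lo hi, v < upperVolume (lo, y))
    (hv2 : ∀ y ∈ Icc lo hi, upperVolume (hi, y) < v)
    (hw1 : ∀ x ∈ Icc lo hi, w < lowerVolume (x, lo))
    (hw2 : ∀ x ∈ Icc lo hi, lowerVolume (x, hi) < w) :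
    ∃ p : ℝ × ℝ, p.1 ∈ Icc lo hi ∧ p.2 ∈ Icc lo hi ∧ upperVolume p = v ∧ lowerVolume p = w := by
  have hbox : ∀ p ∈ Icc lo hi ×ˢ Icc lo hi, p ∈ pressureDomain := fun p hp =>
    ⟨h2.trans_le hp.1.1, h2.trans_le hp.2.1⟩
  -- Since `dA = p.1 dV + p.2 dW`, the gradient of `Ψ` is `(v - V, w - W)`; an interior critical
  -- point is the required bubble.
  let Ψ : ℝ × ℝ → ℝ := fun p =>
    bubbleArea p - p.1 * upperVolume p - p.2 * lowerVolume p + p.1 * v + p.2 * w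
  have hcont : ContinuousOn Ψ (Icc lo hi ×ˢ Icc lo hi) := by
    intro p hp
    have h := hbox p hp
    have h3 := (contDiffAt_bubbleArea h).continuousAt
    have h4 := (contDiffAt_upperVolume h).continuousAt
    have h5 := (contDiffAt_lowerVolume h).continuousAt
    refine ContinuousAt.continuousWithinAt ?_
    fun_prop
  obtain ⟨p, hp, hmin⟩ := (isCompact_Icc.prod isCompact_Icc).exists_isMinOn
    (⟨(lo, lo), ⟨left_mem_Icc.2 hlh.le, left_mem_Icc.2 hlh.le⟩⟩) hcont
  -- At a minimum over the box, the derivative is nonnegative in every direction pointing into the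
  -- box. One-sided directions also cover minima on the boundary.
  have hdir : ∀ d : ℝ × ℝ, (∀ᶠ s in nhdsWithin (0 : ℝ) (Ioi 0),
      p + s • d ∈ Icc lo hi ×ˢ Icc lo hi) →
      0 ≤ d.1 * (v - upperVolume p) + d.2 * (w - lowerVolume p) := by
    intro d hd
    have hγ : HasDerivAt (fun s : ℝ => p + s • d) d 0 := by
      simpa using ((hasDerivAt_id (0 : ℝ)).smul_const d).const_add p
    have h0 : p + (0 : ℝ) • d = p := by simp
    obtain ⟨g₁, g₂, g₃, -, -, -, hV, hW, hA⟩ := hasDerivAt_along_curve hγ (by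
      rw [h0]; exact hbox p hp)
    have hx : HasDerivAt (fun s : ℝ => (p + s • d).1) d.1 0 :=
      (ContinuousLinearMap.fst ℝ ℝ ℝ).hasFDerivAt.comp_hasDerivAt 0 hγ
    have hy : HasDerivAt (fun s : ℝ => (p + s • d).2) d.2 0 :=
      (ContinuousLinearMap.snd ℝ ℝ ℝ).hasFDerivAt.comp_hasDerivAt 0 hγ
    have hΨ : HasDerivAt (fun s : ℝ => Ψ (p + s • d)) _ 0 :=
      ((((hA.sub (hx.mul hV)).sub (hy.mul hW)).add (hx.mul_const v)).add (hy.mul_const w))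
    have h3 := nonneg_of_hasDerivAt_of_right hΨ (hd.mono fun s hs => by
      rw [h0]; exact hmin hs)
    simp only [h0] at h3
    linarith
  obtain ⟨⟨hp1, hp2⟩, ⟨hp3, hp4⟩⟩ := hp
  have hsmall : ∀ ε : ℝ, 0 < ε → ∀ᶠ s in nhdsWithin (0 : ℝ) (Ioi 0), 0 < s ∧ s < ε := fun ε hε =>
    Ioo_mem_nhdsGT hε
  refine ⟨p, ⟨hp1, hp2⟩, ⟨hp3, hp4⟩, ?_, ?_⟩
  · have hlo : p.1 ≠ lo → v ≤ upperVolume p := by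
      intro hne
      have := hdir (-1, 0) ((hsmall (p.1 - lo) (sub_pos.2 (lt_of_le_of_ne hp1 (Ne.symm hne)))).mono
        fun s hs => ⟨⟨by simp; linarith, by simp; linarith⟩, ⟨by simpa, by simpa⟩⟩)
      simp at this; linarith
    have hhi : p.1 ≠ hi → upperVolume p ≤ v := by
      intro hne
      have := hdir (1, 0) ((hsmall (hi - p.1) (sub_pos.2 (lt_of_le_of_ne hp2 hne))).mono
        fun s hs => ⟨⟨by simp; linarith, by simp; linarith⟩, ⟨by simpa, by simpa⟩⟩)
      simp at this; linarith
    -- On the edge `p.1 = lo` the volume exceeds `v`, so moving inward would decrease `Ψ`; the other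
    -- edges are excluded likewise.
    have n1 : p.1 ≠ lo := by
      intro h
      have h3 := hv1 p.2 ⟨hp3, hp4⟩
      rw [← h, Prod.mk.eta] at h3
      linarith [hhi (by rw [h]; exact hlh.ne)]
    have n2 : p.1 ≠ hi := by
      intro h
      have h3 := hv2 p.2 ⟨hp3, hp4⟩
      rw [← h, Prod.mk.eta] at h3
      linarith [hlo n1]
    exact le_antisymm (hhi n2) (hlo n1)
  · have hlo : p.2 ≠ lo → w ≤ lowerVolume p := by
      intro hne
      have := hdir (0, -1) ((hsmall (p.2 - lo) (sub_pos.2 (lt_of_le_of_ne hp3 (Ne.symm hne)))).mono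
        fun s hs => ⟨⟨by simpa, by simpa⟩, ⟨by simp; linarith, by simp; linarith⟩⟩)
      simp at this; linarith
    have hhi : p.2 ≠ hi → lowerVolume p ≤ w := by
      intro hne
      have := hdir (0, 1) ((hsmall (hi - p.2) (sub_pos.2 (lt_of_le_of_ne hp4 hne))).mono
        fun s hs => ⟨⟨by simpa, by simpa⟩, ⟨by simp; linarith, by simp; linarith⟩⟩)
      simp at this; linarith
    have n1 : p.2 ≠ lo := by
      intro h
      have h3 := hw1 p.1 ⟨hp1, hp2⟩
      rw [← h, Prod.mk.eta] at h3
      linarith [hhi (by rw [h]; exact hlh.ne)]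
    have n2 : p.2 ≠ hi := by
      intro h
      have h3 := hw2 p.1 ⟨hp1, hp2⟩
      rw [← h, Prod.mk.eta] at h3
      linarith [hlo n1]
    exact le_antisymm (hhi n2) (hlo n1)

/-- The area of the standard double bubble along a ray of prescribed volumes. -/
theorem hasDerivAt_doubleBubbleArea {p : ℝ × ℝ} (hp : p ∈ pressureDomain) {c t : ℝ} (hc : 0 < c)
    (ht : 0 < t) (hv : upperVolume p = c * t) (hw : lowerVolume p = t) :
    HasDerivAt (fun t => doubleBubbleArea (c * t) t) (c * p.1 + p.2) t := by
  let F : ℝ × ℝ → ℝ × ℝ := fun p => (upperVolume p, lowerVolume p)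
  have hF : HasStrictFDerivAt F (fderiv ℝ F p) p :=
    ((contDiffAt_upperVolume hp).prodMk (contDiffAt_lowerVolume hp)).hasStrictFDerivAt one_ne_zero
  -- The kernel is trivial because the Jacobian is negative definite: pairing `F' h = 0` with `h`
  -- gives a vanishing sum of nonnegative terms.
  have hinj : Function.Injective (fderiv ℝ F p) := by
    refine (injective_iff_map_eq_zero _).2 fun h hh => ?_
    have hγ : HasDerivAt (fun s : ℝ => p + s • h) h 0 := by
      simpa using ((hasDerivAt_id (0 : ℝ)).smul_const h).const_add p
    have h0 : p + (0 : ℝ) • h = p := by simp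
    obtain ⟨g₁, g₂, g₃, hg1, hg2, hg3, hV, hW, -⟩ := hasDerivAt_along_curve hγ (by
      rw [h0]; exact hp)
    have hFγ : HasDerivAt (fun s : ℝ => F (p + s • h)) (fderiv ℝ F p h) 0 :=
      HasFDerivAt.comp_hasDerivAt 0 (by rw [h0]; exact hF.hasFDerivAt) hγ
    rw [hh] at hFγ
    have h3 := hFγ.unique (hV.prodMk hW)
    have h4 := congrArg Prod.fst h3
    have h5 := congrArg Prod.snd h3
    simp only [Prod.fst_zero, Prod.snd_zero] at h4 h5
    have h6 : g₁ * h.1 ^ 2 + g₂ * h.2 ^ 2 + g₃ * (h.2 - h.1) ^ 2 = 0 := by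
      linear_combination h.1 * h4 + h.2 * h5
    have h7 : h.1 = 0 := by
      by_contra h7
      have : 0 < h.1 ^ 2 := by positivity
      nlinarith [mul_pos hg1 this, mul_nonneg hg2.le (sq_nonneg h.2),
        mul_nonneg hg3.le (sq_nonneg (h.2 - h.1))]
    have h8 : h.2 = 0 := by
      by_contra h8
      have : 0 < h.2 ^ 2 := by positivity
      nlinarith [mul_pos hg2 this, mul_nonneg hg1.le (sq_nonneg h.1),
        mul_nonneg hg3.le (sq_nonneg (h.2 - h.1))]
    exact Prod.ext h7 h8
  let e : (ℝ × ℝ) ≃L[ℝ] (ℝ × ℝ) :=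
    (LinearEquiv.ofInjectiveEndo (fderiv ℝ F p).toLinearMap hinj).toContinuousLinearEquiv
  have hF' : HasStrictFDerivAt F (e : (ℝ × ℝ) →L[ℝ] (ℝ × ℝ)) p := by
    have he : (e : (ℝ × ℝ) →L[ℝ] (ℝ × ℝ)) = fderiv ℝ F p := by
      ext1 <;> rfl
    rwa [he]
  let q : ℝ → ℝ × ℝ := fun t => hF'.localInverse F e p (c * t, t)
  have hFp : F p = (c * t, t) := Prod.ext hv hw
  have hqt : q t = p := by
    simp only [q]; rw [← hFp]; exact hF'.localInverse_apply_image
  have hline : HasDerivAt (fun t : ℝ => (c * t, t)) (c, 1) t :=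
    (by simpa using (hasDerivAt_id t).const_mul c : HasDerivAt (fun t => c * t) c t).prodMk
      (hasDerivAt_id t)
  have hq : HasDerivAt q (e.symm (c, 1)) t :=
    HasFDerivAt.comp_hasDerivAt t (l := hF'.localInverse F e p)
      (l' := (e.symm : (ℝ × ℝ) →L[ℝ] (ℝ × ℝ)))
      (by rw [← hFp]; exact hF'.to_localInverse.hasFDerivAt) hline
  have hright : ∀ᶠ s in nhds t, F (q s) = (c * s, s) := by
    have h := hF'.eventually_right_inverse
    rw [hFp] at h
    exact hline.continuousAt.eventually h
  have hdom : ∀ᶠ s in nhds t, q s ∈ pressureDomain :=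
    hq.continuousAt.eventually_mem (isOpen_pressureDomain.mem_nhds (by rwa [hqt]))
  obtain ⟨g₁, g₂, g₃, -, -, -, hV, hW, hA⟩ := hasDerivAt_along_curve hq (by rwa [hqt])
  have hV' : HasDerivAt (fun s => upperVolume (q s)) c t :=
    (by simpa using (hasDerivAt_id t).const_mul c : HasDerivAt (fun t => c * t) c t)
      |>.congr_of_eventuallyEq (hright.mono fun s hs => congrArg Prod.fst hs)
  have hW' : HasDerivAt (fun s => lowerVolume (q s)) 1 t :=
    (hasDerivAt_id t).congr_of_eventuallyEq (hright.mono fun s hs => congrArg Prod.snd hs)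
  -- Along the inverse curve the volumes grow at the prescribed rates `c` and `1`, so the first
  -- variation formula gives the derivative without computing the pressures' rates.
  rw [hV.unique hV', hW.unique hW', hqt] at hA
  refine (hA.congr_of_eventuallyEq ?_).congr_deriv (by ring)
  filter_upwards [hright, hdom, lt_mem_nhds ht] with s hs hd hs0
  have h1 : upperVolume (q s) = c * s := congrArg Prod.fst hs
  have h2 : lowerVolume (q s) = s := congrArg Prod.snd hs
  have h3 := doubleBubbleArea_eq hd (by rw [h1]; positivity) (by rwa [h2])
  rwa [h1, h2] at h3

/-! ### Round spheres -/

/-- Volume of the geodesic ball of radius `log y`. -/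
noncomputable def ballVolume (y : ℝ) : ℝ :=
  Real.pi * ((y ^ 2 - 1 / y ^ 2) / 2 - 2 * Real.log y)

/-- Area of the geodesic sphere of radius `log y`. -/
noncomputable def ballArea (y : ℝ) : ℝ := Real.pi * (y - 1 / y) ^ 2

lemma hasDerivAt_ballVolume {y : ℝ} (hy : 0 < y) :
    HasDerivAt ballVolume (Real.pi * ((y ^ 2 - 1) ^ 2 / y ^ 3)) y := by
  have h1 := hasDerivAt_inv_sq (hasDerivAt_id y) hy.ne'
  refine (((((hasDerivAt_id y).pow 2).sub h1).div_const 2).sub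
    ((Real.hasDerivAt_log hy.ne').const_mul 2)).const_mul Real.pi |>.congr_deriv ?_
  simp only [id]
  field_simp
  norm_num
  ring

/-- Written as the pressure `2 coth (log y)` times the derivative of the volume, so that the second
factor cancels when area is differentiated with respect to volume. -/
lemma hasDerivAt_ballArea {y : ℝ} (hy : 1 < y) : HasDerivAt ballArea
    (2 * (y ^ 2 + 1) / (y ^ 2 - 1) * (Real.pi * ((y ^ 2 - 1) ^ 2 / y ^ 3))) y := by
  have hy0 : y ≠ 0 := by positivity
  have h2 : y ^ 2 - 1 ≠ 0 := by nlinarith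
  have h1 : HasDerivAt (fun y : ℝ => 1 / y) (-1 / y ^ 2) y := by
    simpa [neg_div] using hasDerivAt_inv hy0
  refine ((((hasDerivAt_id y).sub h1).pow 2).const_mul Real.pi).congr_deriv ?_
  simp only [id, Pi.sub_apply, Nat.cast_ofNat, Nat.reduceSub, pow_one]
  field_simp
  ring

lemma strictMonoOn_ballVolume : StrictMonoOn ballVolume (Ici 1) := by
  refine strictMonoOn_of_deriv_pos (convex_Ici 1) (fun y hy =>
    (hasDerivAt_ballVolume (zero_lt_one.trans_le hy)).continuousAt.continuousWithinAt) ?_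
  intro y hy
  rw [interior_Ici] at hy
  have hy : 1 < y := hy
  rw [(hasDerivAt_ballVolume (by linarith)).deriv]
  have : 0 < y ^ 2 - 1 := by nlinarith
  positivity

lemma ballVolume_one : ballVolume 1 = 0 := by simp [ballVolume]

lemma exists_ballVolume_eq {v : ℝ} (hv : 0 < v) : ∃ y, 1 < y ∧ ballVolume y = v := by
  have h1 : v ≤ ballVolume (5 + v) := by
    have h2 : Real.log (5 + v) ≤ 5 + v - 1 := Real.log_le_sub_one_of_pos (by linarith)
    have h3 : 1 / (5 + v) ^ 2 ≤ 1 := by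
      rw [div_le_one (by positivity)]; nlinarith
    have h4 : v ≤ ((5 + v) ^ 2 - 1 / (5 + v) ^ 2) / 2 - 2 * Real.log (5 + v) := by nlinarith
    rw [ballVolume]
    nlinarith [Real.pi_gt_three]
  have hc : ContinuousOn ballVolume (Icc 1 (5 + v)) := fun y hy =>
    (hasDerivAt_ballVolume (zero_lt_one.trans_le hy.1)).continuousAt.continuousWithinAt
  obtain ⟨y, hy, hyv⟩ := intermediate_value_Icc (by linarith) hc
    (show v ∈ Icc (ballVolume 1) (ballVolume (5 + v)) from ⟨by rw [ballVolume_one]; exact hv.le, h1⟩)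
  refine ⟨y, lt_of_le_of_ne hy.1 ?_, hyv⟩
  rintro rfl
  rw [ballVolume_one] at hyv
  exact hv.ne hyv

/-- The substitution `R = (y - 1) / (y + 1)` is `R = tanh (r / 2)` with `y = exp r` and `r` the
hyperbolic radius. -/
lemma isSphereArea_iff {v a : ℝ} (hv : 0 < v) :
    IsSphereArea v a ↔ ∃ y, 1 < y ∧ ballVolume y = v ∧ a = ballArea y := by
  have key : ∀ y : ℝ, 1 < y → 0 < (y - 1) / (y + 1) ∧ (y - 1) / (y + 1) < 1 ∧
      hypVolume (roundBall ((y - 1) / (y + 1))) = ENNReal.ofReal (ballVolume y) ∧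
      roundSphereArea ((y - 1) / (y + 1)) = ballArea y := by
    intro y hy
    have h0 : 0 < (y - 1) / (y + 1) := div_pos (by linarith) (by linarith)
    have h1 : (y - 1) / (y + 1) < 1 := by rw [div_lt_one (by linarith)]; linarith
    have hy0 : 0 < y := by linarith
    refine ⟨h0, h1, ?_, ?_⟩
    · rw [hypVolume_roundBall h0 h1, ← Real.log_div (by linarith) (by linarith)]
      have h2 : (1 + (y - 1) / (y + 1)) / (1 - (y - 1) / (y + 1)) = y := by
        have : y + 1 ≠ 0 := by linarith
        field_simp
        ring
      have h3 : 1 - ((y - 1) / (y + 1)) ^ 2 = 4 * y / (y + 1) ^ 2 := by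
        field_simp; ring
      rw [h2, h3, ballVolume]
      congr 1
      field_simp
      ring
    · have h3 : 1 - ((y - 1) / (y + 1)) ^ 2 = 4 * y / (y + 1) ^ 2 := by
        field_simp; ring
      rw [roundSphereArea_eq h0, h3, ballArea]
      field_simp
      ring
  constructor
  · rintro ⟨R, h0, h1, h2, h3⟩
    have hy : 1 < (1 + R) / (1 - R) := by rw [lt_div_iff₀ (by linarith)]; linarith
    have hR : ((1 + R) / (1 - R) - 1) / ((1 + R) / (1 - R) + 1) = R := by
      have : 1 - R ≠ 0 := by linarith
      field_simp
      ring
    obtain ⟨-, -, h4, h5⟩ := key _ hy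
    rw [hR] at h4 h5
    rw [h4] at h2
    exact ⟨_, hy, eq_of_ofReal_eq hv h2, h3.trans h5⟩
  · rintro ⟨y, hy, h1, h2⟩
    obtain ⟨h3, h4, h5, h6⟩ := key y hy
    exact ⟨_, h3, h4, by rw [h5, h1], by rw [h6, h2]⟩

lemma ballVolume_pos {y : ℝ} (hy : 1 < y) : 0 < ballVolume y := by
  rw [← ballVolume_one]
  exact strictMonoOn_ballVolume self_mem_Ici hy.le hy

lemma isSphereArea_iff_eq {y a : ℝ} (hy : 1 < y) :
    IsSphereArea (ballVolume y) a ↔ a = ballArea y := by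
  rw [isSphereArea_iff (ballVolume_pos hy)]
  constructor
  · rintro ⟨x, hx, h1, rfl⟩
    rw [strictMonoOn_ballVolume.injOn (mem_Ici.2 hx.le) (mem_Ici.2 hy.le) h1]
  · exact fun h => ⟨y, hy, rfl, h⟩

lemma sphereArea_eq {y : ℝ} (hy : 1 < y) : sphereArea (ballVolume y) = ballArea y := by
  simp only [sphereArea, isSphereArea_iff_eq hy]
  exact csInf_singleton _

lemma existsUnique_isSphereArea {v : ℝ} (hv : 0 < v) : ∃! a, IsSphereArea v a := by
  obtain ⟨y, hy, rfl⟩ := exists_ballVolume_eq hv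
  exact ⟨ballArea y, (isSphereArea_iff_eq hy).2 rfl, fun a ha => (isSphereArea_iff_eq hy).1 ha⟩

theorem hasDerivAt_sphereArea {y : ℝ} (hy : 1 < y) :
    HasDerivAt sphereArea (2 * (y ^ 2 + 1) / (y ^ 2 - 1)) (ballVolume y) := by
  have hy0 : 0 < y := by linarith
  have hne : Real.pi * ((y ^ 2 - 1) ^ 2 / y ^ 3) ≠ 0 := by
    have : 0 < y ^ 2 - 1 := by nlinarith
    positivity
  have hs : HasStrictDerivAt ballVolume (Real.pi * ((y ^ 2 - 1) ^ 2 / y ^ 3)) y := by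
    refine hasStrictDerivAt_of_hasDerivAt_of_continuousAt
      (f' := fun y => Real.pi * ((y ^ 2 - 1) ^ 2 / y ^ 3)) ?_ ?_
    · filter_upwards [lt_mem_nhds hy0] with x hx using hasDerivAt_ballVolume hx
    · refine continuousAt_const.mul (ContinuousAt.div (by fun_prop) (by fun_prop) (by positivity))
  have hF := hs.hasStrictFDerivAt_equiv hne
  have hinv := hs.to_localInverse hne
  have hval : hs.localInverse _ _ _ hne (ballVolume y) = y := hF.localInverse_apply_image
  have hright : ∀ᶠ v in nhds (ballVolume y), ballVolume (hs.localInverse _ _ _ hne v) = v :=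
    hF.eventually_right_inverse
  have hev : ∀ᶠ v in nhds (ballVolume y), 1 < hs.localInverse _ _ _ hne v :=
    hinv.hasDerivAt.continuousAt.eventually_mem (by rw [hval]; exact lt_mem_nhds hy)
  have hA := HasDerivAt.comp (ballVolume y) (h₂ := ballArea)
    (by rw [hval]; exact hasDerivAt_ballArea hy) hinv.hasDerivAt
  refine (hA.congr_of_eventuallyEq ?_).congr_deriv (by field_simp)
  filter_upwards [hright, hev] with v hv hv1
  have := sphereArea_eq hv1
  rwa [hv] at this

/-! ### Asymptotics of the volumes of large double bubbles -/

/-- Exchanging the two pressures reflects the bubble in the plane of its rim, so every estimate is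
needed for one chamber only. -/
lemma bubble_swap (p : ℝ × ℝ) : bubbleK p.swap = bubbleK p ∧ bubbleRho p.swap = bubbleRho p ∧
    bubbleTheta p.swap = -bubbleTheta p := by
  have h : bubbleK p.swap = bubbleK p := by
    unfold bubbleK; congr 1; simp only [Prod.fst_swap, Prod.snd_swap]; ring
  refine ⟨h, by rw [bubbleRho, bubbleRho, h], ?_⟩
  rw [bubbleTheta, bubbleTheta, ← Real.arctan_neg, Prod.fst_swap, Prod.snd_swap]
  congr 1
  rw [← neg_div, add_comm]
  ring

lemma upperVolume_swap (p : ℝ × ℝ) : upperVolume p.swap = lowerVolume p := by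
  obtain ⟨-, h2, h3⟩ := bubble_swap p
  rw [upperVolume, lowerVolume, h2, h3, capVolume_neg, sub_neg_eq_add]
  ring_nf

lemma two_div_pi_mul_lensVolume {ρ u : ℝ} (h1 : -1 < u) (h2 : u < 1) :
    2 / Real.pi * lensVolume ρ u = 4 * u * (1 + ρ ^ 2) / ((1 - ρ ^ 2) * (1 - u ^ 2)) -
      2 * Real.log ((1 + u) / (1 - u)) := by
  rw [Real.log_div (by linarith) (by linarith), lensVolume]
  have := Real.pi_pos.ne'
  field_simp
  ring

/-- The volume of an outer cap in terms of its pressure `2 + δ`. -/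
lemma lens_pressure_identity {r u δ : ℝ} (hur : r < u) (hu : u < 1) (h0 : 0 < r)
    (hδ : δ = 2 * (u - r) * (1 - u) / (r + u ^ 2)) :
    4 * u * (1 + r) / ((1 - r) * (1 - u ^ 2)) = 4 / δ -
        2 * (r * (1 - r) + 4 * r * u - (1 - r) * u ^ 2) / ((u - r) * (1 - r) * (1 + u)) ∧
      (1 + u) / (1 - u) = 4 / δ / 2 * ((1 + u) * (u - r) / (r + u ^ 2)) := by
  have h1 : u - r ≠ 0 := by linarith
  have h2 : 1 - u ≠ 0 := by linarith
  have h3 : 1 - r ≠ 0 := by linarith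
  have h4 : 1 + u ≠ 0 := by linarith
  have h5 : r + u ^ 2 ≠ 0 := by positivity
  have h6 : 1 - u ^ 2 = (1 - u) * (1 + u) := by ring
  subst hδ
  rw [h6]
  constructor
  · field_simp
    ring
  · field_simp
    norm_num

/-- As both pressures tend to `2`, `r` tends to `1 / 3` and `u` to `1`; in the preceding identity
the rational correction tends to `2` and the factor inside the logarithm to `1`. The loss `2.09 = 2
+ 2 * 0.045` allows for pressures up to `2 + 1 / 39`. -/
lemma lens_pressure_bounds {r u δ : ℝ} (hr1 : 0.315 ≤ r) (hr2 : r ≤ 1 / 3) (hu1 : 0.561 < u)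
    (hu2 : u < 1) (hδ : δ = 2 * (u - r) * (1 - u) / (r + u ^ 2)) (hδ0 : 0 < δ) (hδ1 : δ ≤ 1 / 39)
    (hk : 16 / 3 + 8 / 3 * δ ≤ (1 + r) ^ 2 / r) :
    4 / δ - 2.09 - 2 * Real.log (4 / δ / 2) ≤ 4 * u * (1 + r) / ((1 - r) * (1 - u ^ 2)) -
        2 * Real.log ((1 + u) / (1 - u)) ∧
      4 * u * (1 + r) / ((1 - r) * (1 - u ^ 2)) - 2 * Real.log ((1 + u) / (1 - u)) ≤
        4 / δ - 1 := by
  have hq : 0 < r + u ^ 2 := by positivity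
  have hδ' : δ * (r + u ^ 2) = 2 * (u - r) * (1 - u) := by rw [hδ]; field_simp
  have hu3 : 0.92 ≤ u := by nlinarith
  have hx : 1 - u ≤ 1.05 * δ := by
    have h1 : r + u ^ 2 ≤ 2.1 * (u - r) := by nlinarith
    have h2 : 2 * (u - r) * (1 - u) ≤ δ * (2.1 * (u - r)) := by
      rw [← hδ']; exact mul_le_mul_of_nonneg_left h1 hδ0.le
    have h3 : 0 < u - r := by linarith
    nlinarith
  have hu4 : 0.973 ≤ u := by linarith
  -- The correction equals `2` exactly at the corner `r = 1 / 3`, `u = 1`, so `r ≤ 1 / 3` alone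
  -- leaves no room. The hypothesis `hk` makes `r` drop in proportion to `δ`, hence to `1 - u`.
  have hr3 : r ≤ 1 / 3 - 0.29 * (1 - u) := by
    rw [le_div_iff₀ (by linarith)] at hk
    nlinarith
  obtain ⟨e1, e2⟩ := lens_pressure_identity (by linarith) hu2 (by linarith) hδ
  have hden : 0 < (u - r) * (1 - r) * (1 + u) := by
    have : 0 < u - r := by linarith
    have : 0 < 1 - r := by linarith
    have : 0 < 1 + u := by linarith
    positivity
  constructor
  · have hB : 2 * (r * (1 - r) + 4 * r * u - (1 - r) * u ^ 2) / ((u - r) * (1 - r) * (1 + u)) ≤ 2 := by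
      rw [div_le_iff₀ hden]
      obtain ⟨x, rfl⟩ : ∃ x, u = 1 - x := ⟨1 - u, by ring⟩
      have h1 : 0 ≤ (1 / 3 - r - 0.29 * x) * (3 - r) :=
        mul_nonneg (by linarith) (by linarith)
      have h2 : 0 ≤ x * (r - 0.315) := mul_nonneg (by linarith) (by linarith)
      have h3 : 0 ≤ x * (1 / 3 - r) := mul_nonneg (by linarith) (by linarith)
      have h4 : 0 ≤ x * (r - 0.315) * r := mul_nonneg h2 (by linarith)
      have h5 : 0 ≤ x * (1 / 3 - r) * r := mul_nonneg h3 (by linarith)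
      have h6 : 0 ≤ x ^ 2 * (1 - r) := mul_nonneg (sq_nonneg x) (by linarith)
      nlinarith
    have hC : Real.log ((1 + u) * (u - r) / (r + u ^ 2)) ≤ 0.045 := by
      have h1 : 0 < (1 + u) * (u - r) / (r + u ^ 2) :=
        div_pos (mul_pos (by linarith) (by linarith)) hq
      have h2 := Real.log_le_sub_one_of_pos h1
      have h3 : (1 + u) * (u - r) / (r + u ^ 2) ≤ 1.045 := by
        rw [div_le_iff₀ hq]; nlinarith
      linarith
    rw [e1, e2, Real.log_mul (by positivity) (div_pos (mul_pos (by linarith) (by linarith)) hq).ne']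
    linarith
  · have hB : 0 ≤ 2 * (r * (1 - r) + 4 * r * u - (1 - r) * u ^ 2) / ((u - r) * (1 - r) * (1 + u)) := by
      refine div_nonneg ?_ hden.le
      nlinarith
    have hl : 1 ≤ Real.log ((1 + u) / (1 - u)) := by
      rw [Real.le_log_iff_exp_le (div_pos (by linarith) (by linarith)), le_div_iff₀ (by linarith)]
      nlinarith [Real.exp_one_lt_d9]
    linarith

section
variable {p : ℝ × ℝ}

/-- At pressures `(2, 2)` one has `(1 + r) ^ 2 / r = 16 / 3`, whose root below one is `r = 1 / 3`.
Raising the pressures raises this quotient and lowers `r`. -/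
lemma bubbleRho_sq_bounds (hp : p ∈ pressureDomain) (h1 : p.1 ≤ 2 + 1 / 39) (h2 : p.2 ≤ 2 + 1 / 39) :
    0.315 ≤ bubbleRho p ^ 2 ∧ bubbleRho p ^ 2 ≤ 1 / 3 ∧
      16 / 3 + 8 / 3 * (p.1 - 2) ≤ (1 + bubbleRho p ^ 2) ^ 2 / bubbleRho p ^ 2 := by
  have h0 := bubbleRho_pos hp
  have h3 := bubbleRho_sq_lt_one hp
  have hk : (1 + bubbleRho p ^ 2) ^ 2 / bubbleRho p ^ 2 =
      4 / 3 * (p.1 ^ 2 + p.2 ^ 2 - p.1 * p.2) := by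
    rw [← bubbleK_sq, ← bubbleRho_eq hp, div_pow]
  obtain ⟨h4, h5⟩ := hp
  have h6 : 16 / 3 + 8 / 3 * (p.1 - 2) ≤ 4 / 3 * (p.1 ^ 2 + p.2 ^ 2 - p.1 * p.2) := by
    nlinarith [sq_nonneg (p.1 - 2)]
  have h7 : 4 / 3 * (p.1 ^ 2 + p.2 ^ 2 - p.1 * p.2) ≤ 5.48 := by
    nlinarith [mul_pos (sub_pos.2 h4) (sub_pos.2 h5)]
  rw [hk]
  have h8 : 0 < bubbleRho p ^ 2 := by positivity
  rw [div_eq_iff h8.ne'] at hk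
  generalize bubbleRho p ^ 2 = r at *
  refine ⟨?_, ?_, h6⟩
  · by_contra! hcon
    nlinarith
  · by_contra! hcon
    nlinarith

lemma abs_sin_bubbleTheta_le (hp : p ∈ pressureDomain) (h1 : p.1 ≤ 2 + 1 / 39)
    (h2 : p.2 ≤ 2 + 1 / 39) : |Real.sin (bubbleTheta p)| ≤ 1 / 89 := by
  have h3 := bubbleK_mul_sin hp
  have h4 := bubbleK_sq_ge hp
  have h5 := two_lt_bubbleK hp
  have h6 : 2.3 < bubbleK p := by nlinarith
  have h7 : |p.2 - p.1| ≤ 1 / 39 := by rw [abs_le]; constructor <;> linarith [hp.1, hp.2]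
  rw [← h3, abs_mul, abs_of_pos (by linarith)] at h7
  nlinarith [abs_nonneg (Real.sin (bubbleTheta p))]

lemma neg_pi_div_six_lt_bubbleTheta (hp : p ∈ pressureDomain) (h1 : p.1 ≤ 2 + 1 / 39)
    (h2 : p.2 ≤ 2 + 1 / 39) : -(Real.pi / 6) < bubbleTheta p := by
  by_contra! hcon
  have h3 := abs_bubbleTheta_lt hp
  have h4 : Real.sin (bubbleTheta p) ≤ Real.sin (-(Real.pi / 6)) :=
    Real.sin_le_sin_of_le_of_le_pi_div_two (by linarith) (by linarith [Real.pi_pos]) hcon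
  rw [Real.sin_neg, Real.sin_pi_div_six] at h4
  have h5 := abs_le.1 (abs_sin_bubbleTheta_le hp h1 h2)
  linarith

/-- The pressures differ by less than `1 / 39`, so the separating cap is nearly flat. The resulting
`0.06` turns the loss `2.09` of a single cap into `2.15` for a chamber. -/
lemma abs_capVolume_middle_le (hp : p ∈ pressureDomain) (h1 : p.1 ≤ 2 + 1 / 39)
    (h2 : p.2 ≤ 2 + 1 / 39) :
    |2 / Real.pi * capVolume (bubbleRho p) (bubbleTheta p)| ≤ 0.06 := by
  have key : ∀ q ∈ pressureDomain, q.1 ≤ 2 + 1 / 39 → q.2 ≤ 2 + 1 / 39 → 0 ≤ bubbleTheta q →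
      |2 / Real.pi * capVolume (bubbleRho q) (bubbleTheta q)| ≤ 0.06 := by
    intro q hq h1 h2 h0
    rcases h0.eq_or_lt with h0 | h0
    · rw [← h0]; simp [capVolume, lensVolume]; norm_num
    have hθ := abs_bubbleTheta_lt hq
    have hpi := Real.pi_pos
    have hτ1 := (abs_lt.1 (abs_tan_middle_lt hq)).2
    have hτ0 := tan_half_pos h0 (by linarith)
    obtain ⟨hr1, hr2, -⟩ := bubbleRho_sq_bounds hq h1 h2
    have hρ := bubbleRho_pos hq
    have hρ1 := bubbleRho_lt_one hq
    have hs := (abs_le.1 (abs_sin_bubbleTheta_le hq h1 h2)).2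
    have hu : bubbleRho q * Real.tan (bubbleTheta q / 2) < 1 := by nlinarith
    have hnn := capVolume_nonneg hρ hρ1 h0 (by linarith) hu
    rw [abs_of_nonneg (by positivity)]
    rw [capVolume, two_div_pi_mul_lensVolume (by nlinarith [mul_pos hρ hτ0]) hu]
    rw [sin_eq_tan_half (middle_cos_ne hq), div_le_iff₀ (by positivity)] at hs
    generalize Real.tan (bubbleTheta q / 2) = τ at *
    have hτ2 : τ ≤ 1 / 89 := by nlinarith
    have hρ2 : bubbleRho q ≤ 0.578 := by nlinarith
    have hu0 : 0 < bubbleRho q * τ := by positivity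
    have hu2 : bubbleRho q * τ ≤ 0.0065 := by nlinarith
    generalize bubbleRho q * τ = u at *
    generalize bubbleRho q ^ 2 = r at *
    have hl : 0 ≤ Real.log ((1 + u) / (1 - u)) :=
      Real.log_nonneg (by rw [le_div_iff₀ (by linarith)]; linarith)
    have hm : 4 * u * (1 + r) / ((1 - r) * (1 - u ^ 2)) ≤ 0.06 := by
      have h5 : 0.99 ≤ 1 - u ^ 2 := by nlinarith
      have h6 : 0.66 ≤ (1 - r) * (1 - u ^ 2) := by nlinarith
      rw [div_le_iff₀ (by linarith)]
      nlinarith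
    linarith
  rcases le_total 0 (bubbleTheta p) with h | h
  · exact key p hp h1 h2 h
  · obtain ⟨-, e2, e3⟩ := bubble_swap p
    have := key p.swap ⟨hp.2, hp.1⟩ h2 h1 (by rw [e3]; linarith)
    rwa [e2, e3, capVolume_neg, mul_neg, abs_neg] at this

theorem upperVolume_bounds (hp : p ∈ pressureDomain) (h1 : p.1 ≤ 2 + 1 / 39)
    (h2 : p.2 ≤ 2 + 1 / 39) :
    4 / (p.1 - 2) - 2.15 - 2 * Real.log (4 / (p.1 - 2) / 2) ≤ 2 / Real.pi * upperVolume p ∧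
      2 / Real.pi * upperVolume p < 4 / (p.1 - 2) := by
  obtain ⟨hr1, hr2, hk⟩ := bubbleRho_sq_bounds hp h1 h2
  have hθ := abs_bubbleTheta_lt hp
  have hθ6 := neg_pi_div_six_lt_bubbleTheta hp h1 h2
  have hm := abs_le.1 (abs_capVolume_middle_le hp h1 h2)
  have hρ := bubbleRho_pos hp
  have hu := (upper_apex hp).2
  have hpi := Real.pi_pos
  -- The equation for `δ` is small both for `u` near `r` and for `u` near `1`. The bound `τ > 1`,
  -- hence `u > ρ > 0.561`, selects the second branch.
  have hτ : 1 < Real.tan ((bubbleTheta p + 2 * Real.pi / 3) / 2) := by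
    rw [← Real.tan_pi_div_four]
    refine Real.tan_lt_tan_of_lt_of_lt_pi_div_two ?_ ?_ ?_ <;> linarith
  have hpr := capPressure_upper hp
  rw [capPressure, sin_eq_tan_half (upper_cos_ne hp)] at hpr
  have hu1 : 0.561 < bubbleRho p * Real.tan ((bubbleTheta p + 2 * Real.pi / 3) / 2) := by
    have : 0.561 < bubbleRho p := by nlinarith
    nlinarith
  have hδ : p.1 - 2 = 2 * (bubbleRho p * Real.tan ((bubbleTheta p + 2 * Real.pi / 3) / 2) -
      bubbleRho p ^ 2) * (1 - bubbleRho p * Real.tan ((bubbleTheta p + 2 * Real.pi / 3) / 2)) /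
      (bubbleRho p ^ 2 + (bubbleRho p * Real.tan ((bubbleTheta p + 2 * Real.pi / 3) / 2)) ^ 2) := by
    rw [← hpr]
    field_simp
    ring
  have hb := lens_pressure_bounds hr1 hr2 hu1 hu hδ (by linarith [hp.1]) (by linarith) hk
  rw [upperVolume, mul_sub, capVolume, two_div_pi_mul_lensVolume (by linarith) hu]
  constructor
  · linarith [hb.1]
  · linarith [hb.2]

end

/-! ### The derivative of the Hutchings function -/

/-- The volume equation reads `y ^ 2 = a + 1 / y ^ 2 + 4 log y`; feeding the crude `y ^ 2 ≥ a` back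
into the logarithm gives the bound. -/
lemma le_sq_sub_one_of_ballVolume {y a : ℝ} (hy : 1 < y) (ha : 1 ≤ a)
    (h : 2 / Real.pi * ballVolume y = a) : a + 2 * Real.log a - 1 ≤ y ^ 2 - 1 := by
  have hpi := Real.pi_pos.ne'
  have h1 : y ^ 2 - 1 / y ^ 2 - 4 * Real.log y = a := by
    rw [← h, ballVolume]; field_simp; ring
  have h2 : 0 < 1 / y ^ 2 := by positivity
  have h3 : 0 < Real.log y := Real.log_pos hy
  have h4 : Real.log a ≤ 2 * Real.log y := by
    have : Real.log (y ^ 2) = 2 * Real.log y := by rw [Real.log_pow]; norm_num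
    rw [← this]
    exact Real.log_le_log (by linarith) (by linarith)
  linarith

/-- The implicit inequality for `y` is solved by bounding the logarithm above by its tangent at `b`.
-/
lemma mul_le_of_log_le {y b c : ℝ} (hy : 0 < y) (hb : 0 < b)
    (h : y - c - 2 * Real.log (y / 2) ≤ b) :
    (y - b) * (1 - 2 / b) ≤ c + 2 * Real.log (b / 2) := by
  have h1 : Real.log (y / 2) = Real.log (b / 2) + Real.log (y / b) := by
    rw [← Real.log_mul (by positivity) (by positivity)]
    congr 1
    field_simp
  have h2 := Real.log_le_sub_one_of_pos (div_pos hy hb)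
  have h3 : (y - b) * (1 - 2 / b) = y - b - 2 * (y / b - 1) := by field_simp
  rw [h3]
  linarith

/-- Alternating truncation of the geometric series: `1 / (1 + x) ≤ 1 - x + x ^ 2` at `x = q * z`.
Its companion below stops after `x ^ 3`. -/
lemma div_le_of_mul_add_le {α q z s σ E : ℝ} (hα : 0 < α) (hq : α * q = 1) (hz : 0 ≤ z)
    (hs : 0 < s) (hsσ : s * σ = 1) (hE : s * (α + z) ≤ E) :
    α / E ≤ σ * (1 - q * z + (q * z) ^ 2) := by
  have hσ : 0 < σ := pos_of_mul_pos_right (hsσ ▸ one_pos) hs.le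
  have hq0 : 0 < q := pos_of_mul_pos_right (hq ▸ one_pos) hα.le
  rw [div_le_iff₀ (lt_of_lt_of_le (by positivity) hE)]
  have h1 : σ * (1 - q * z + (q * z) ^ 2) * (s * (α + z)) = α * (1 + (q * z) ^ 3) := by
    linear_combination (1 - q * z + (q * z) ^ 2) * (α + z) * hsσ -
      (z - q * z ^ 2 + q ^ 2 * z ^ 3) * hq
  have h2 : 0 ≤ σ * (1 - q * z + (q * z) ^ 2) := by
    have : 0 ≤ 1 - q * z + (q * z) ^ 2 := by nlinarith [sq_nonneg (q * z - 1 / 2)]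
    positivity
  have h3 : 0 ≤ (q * z) ^ 3 := by positivity
  nlinarith [mul_le_mul_of_nonneg_left hE h2]

lemma le_div_of_le_mul_add {α q z s σ y : ℝ} (hα : 0 < α) (hq : α * q = 1) (hz : 0 ≤ z)
    (hs : 0 < s) (hsσ : s * σ = 1) (hy : 0 < y) (h : y ≤ s * (α + z)) :
    σ * (1 - q * z + (q * z) ^ 2 - (q * z) ^ 3) ≤ α / y := by
  have hσ : 0 < σ := pos_of_mul_pos_right (hsσ ▸ one_pos) hs.le
  have hq0 : 0 < q := pos_of_mul_pos_right (hq ▸ one_pos) hα.le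
  have h1 : σ * (1 - q * z + (q * z) ^ 2 - (q * z) ^ 3) * (s * (α + z)) =
      α * (1 - (q * z) ^ 4) := by
    linear_combination (1 - q * z + (q * z) ^ 2 - (q * z) ^ 3) * (α + z) * hsσ -
      (z - q * z ^ 2 + q ^ 2 * z ^ 3 - q ^ 3 * z ^ 4) * hq
  have h2 : α / (s * (α + z)) ≤ α / y := div_le_div_of_nonneg_left hα.le hy h
  refine le_trans ?_ h2
  rw [le_div_iff₀ (by positivity), h1]
  have : 0 ≤ (q * z) ^ 4 := by positivity
  nlinarith

lemma inv_slope_bounds {c q : ℝ} (hc1 : 0.847264 < c) (hc2 : c < 0.847265) (hq : c * q = 1) :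
    1.1802 ≤ q ∧ q ^ 2 ≤ 1.3933 ∧ 2 * q ^ 3 ≤ 3.29 := by
  have h0 : 0 < q := pos_of_mul_pos_right (hq ▸ one_pos) (by linarith)
  have h1 : q ≤ 1.18028 := by nlinarith
  have h2 := pow_le_pow_left₀ h0.le h1 2
  have h3 := pow_le_pow_left₀ h0.le h1 3
  norm_num at h2 h3 ⊢
  exact ⟨by nlinarith, by linarith, by linarith⟩

lemma inv_one_add_slope_bounds {c m : ℝ} (hc1 : 0.847264 < c) (hc2 : c < 0.847265)
    (hm : (1 + c) * m = 1) : 0.5413 ≤ m ∧ m ^ 2 ≤ 0.2931 := by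
  have h0 : 0 < m := pos_of_mul_pos_right (hm ▸ one_pos) (by linarith)
  have h1 : m ≤ 0.54135 := by nlinarith
  have h2 := pow_le_pow_left₀ h0.le h1 2
  norm_num at h2 ⊢
  exact ⟨by nlinarith, by linarith⟩

/-- Comparison of the two sides of the critical inequality by expanding in powers of `σ = 1 / s`. -/
lemma sum_div_lt_of_expansion {c s σ E₁ E₂ E₃ y₁ y₂ a₁ a₂ a₃ b₁ b₂ : ℝ} (hc1 : 0.847264 < c)
    (hc2 : c < 0.847265) (hs : 0 < s) (hsσ : s * σ = 1) (hy₁ : 0 < y₁) (hy₂ : 0 < y₂)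
    (ha₁ : 0 ≤ a₁) (ha₂ : 0 ≤ a₂) (ha₃ : 0 ≤ a₃) (hb₁ : 0 ≤ b₁) (hb₂ : 0 ≤ b₂)
    (hA : 0 ≤ 4 * a₁ - 2 * b₁) (hB : 0 ≤ 8 * a₁ ^ 2 - 2 * b₁ ^ 2)
    (e1 : s * (c / 2 + a₁ * σ) ≤ E₁) (e2 : s * (1 + a₂ * σ) ≤ E₂)
    (e3 : s * ((1 + c) + a₃ * σ) ≤ E₃) (f1 : y₁ ≤ s * (c + b₁ * σ)) (f2 : y₂ ≤ s * (1 + b₂ * σ))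
    (hpoly : 0 < 1.1802 * (4 * a₁ - 2 * b₁) + a₂ + 0.5413 * a₃ - 2 * b₂ -
      σ * (1.3933 * (8 * a₁ ^ 2 - 2 * b₁ ^ 2) + a₂ ^ 2 + 0.2931 * a₃ ^ 2 - 2 * b₂ ^ 2) -
      σ ^ 2 * (3.29 * b₁ ^ 3 + 2 * b₂ ^ 3)) :
    c / E₁ + 1 / E₂ + (1 + c) / E₃ < 2 * c / y₁ + 2 / y₂ := by
  have hσ0 : 0 < σ := pos_of_mul_pos_right (hsσ ▸ one_pos) hs.le
  have hc0 : 0 < c := by linarith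
  obtain ⟨q, hq⟩ : ∃ q, c * q = 1 := ⟨1 / c, by field_simp⟩
  obtain ⟨m, hm⟩ : ∃ m, (1 + c) * m = 1 := ⟨1 / (1 + c), by field_simp⟩
  have hq0 : 0 < q := pos_of_mul_pos_right (hq ▸ one_pos) hc0.le
  have hm0 : 0 < m := pos_of_mul_pos_right (hm ▸ one_pos) (by linarith)
  have k1 := div_le_of_mul_add_le (q := 2 * q) (half_pos hc0) (by linarith) (by positivity) hs hsσ e1
  have k2 := div_le_of_mul_add_le (q := 1) one_pos (by norm_num) (by positivity) hs hsσ e2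
  have k3 := div_le_of_mul_add_le (by positivity) hm (by positivity) hs hsσ e3
  have k4 := le_div_of_le_mul_add hc0 hq (by positivity) hs hsσ hy₁ f1
  have k5 := le_div_of_le_mul_add (q := 1) one_pos (by norm_num) (by positivity) hs hsσ hy₂ f2
  obtain ⟨⟨c1, c2, c3⟩, c4, c5⟩ := And.intro (inv_slope_bounds hc1 hc2 hq)
    (inv_one_add_slope_bounds hc1 hc2 hm)
  have m1 := mul_le_mul_of_nonneg_right c1 hA
  have m2 := mul_le_mul_of_nonneg_left (mul_le_mul_of_nonneg_right c2 hB) hσ0.le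
  have m3 := mul_le_mul_of_nonneg_left (mul_le_mul_of_nonneg_right c3 (pow_nonneg hb₁ 3))
    (sq_nonneg σ)
  have m4 := mul_le_mul_of_nonneg_right c4 ha₃
  have m5 := mul_le_mul_of_nonneg_left (mul_le_mul_of_nonneg_right c5 (sq_nonneg a₃)) hσ0.le
  -- After division by `σ ^ 2`, this is the difference of the truncated expansions: the terms in `σ`
  -- have cancelled. The decimals in `hpoly` are bounds for powers of `q = 1 / c` and `m = 1 / (1 +
  -- c)`, each taken in the unfavourable direction.
  have hpos : 0 < q * (4 * a₁ - 2 * b₁) + a₂ + m * a₃ - 2 * b₂ -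
        σ * (q ^ 2 * (8 * a₁ ^ 2 - 2 * b₁ ^ 2) + a₂ ^ 2 + m ^ 2 * a₃ ^ 2 -
          2 * b₂ ^ 2) - σ ^ 2 * (2 * q ^ 3 * b₁ ^ 3 + 2 * b₂ ^ 3) := by
    refine hpoly.trans_le ?_
    linear_combination m1 + m2 + m3 + m4 + m5
  have hfin := mul_pos (pow_pos hσ0 2) hpos
  have r1 : c / E₁ = 2 * (c / 2 / E₁) := by ring
  have r4 : 2 * c / y₁ = 2 * (c / y₁) := by ring
  have r5 : 2 / y₂ = 2 * (1 / y₂) := by ring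
  rw [r1, r4, r5]
  linear_combination 2 * k1 + k2 + k3 + 2 * k4 + 2 * k5 + hfin

/-- The second-order part is about `2.96 + 3.70 x`. The two higher-order parts cost at most `1.1 +
x` and `0.3 + x`, because `σ` is at most `1 / (190.9 (1 + x))`. -/
lemma critical_polynomial {x σ : ℝ} (hx : 0 ≤ x) (hσ : 0 < σ) (hσx : σ * (190.9 * (1 + x)) ≤ 1) :
    0 < 1.1802 * (4 * (2 * x + 7.78) - 2 * (2.0252 * x + 11.11)) + (2 * x + 9.5) +
      0.5413 * (2 * x + 10.72) - 2 * (2.0212 * x + 11.42) -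
      σ * (1.3933 * (8 * (2 * x + 7.78) ^ 2 - 2 * (2.0252 * x + 11.11) ^ 2) + (2 * x + 9.5) ^ 2 +
        0.2931 * (2 * x + 10.72) ^ 2 - 2 * (2.0212 * x + 11.42) ^ 2) -
      σ ^ 2 * (3.29 * (2.0252 * x + 11.11) ^ 3 + 2 * (2.0212 * x + 11.42) ^ 3) := by
  have h1 : 1.3933 * (8 * (2 * x + 7.78) ^ 2 - 2 * (2.0252 * x + 11.11) ^ 2) + (2 * x + 9.5) ^ 2 +
        0.2931 * (2 * x + 10.72) ^ 2 - 2 * (2.0212 * x + 11.42) ^ 2 ≤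
      190.9 * (1 + x) * (1.1 + x) := by nlinarith
  have h2 : 3.29 * (2.0252 * x + 11.11) ^ 3 + 2 * (2.0212 * x + 11.42) ^ 3 ≤
      (190.9 * (1 + x)) ^ 2 * (0.3 + x) := by
    have : 0 ≤ x ^ 3 := by positivity
    nlinarith [sq_nonneg x]
  have h3 : σ * (190.9 * (1 + x) * (1.1 + x)) ≤ 1.1 + x := by nlinarith
  have h4 : σ ^ 2 * ((190.9 * (1 + x)) ^ 2 * (0.3 + x)) ≤ 0.3 + x := by
    have h5 : (σ * (190.9 * (1 + x))) ^ 2 ≤ 1 := pow_le_one₀ (by positivity) hσx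
    nlinarith
  have h5 := mul_le_mul_of_nonneg_left h1 hσ.le
  have h6 := mul_le_mul_of_nonneg_left h2 (sq_nonneg σ)
  nlinarith

lemma exp_nat_lt (n : ℕ) (hn : n ≠ 0) : (2.7182818283 : ℝ) ^ n < Real.exp n ∧
    Real.exp n < (2.7182818286 : ℝ) ^ n := by
  have h : Real.exp n = Real.exp 1 ^ n := by rw [← Real.exp_nat_mul, mul_one]
  rw [h]
  exact ⟨pow_lt_pow_left₀ Real.exp_one_gt_d9 (by norm_num) hn,
    pow_lt_pow_left₀ Real.exp_one_lt_d9 (Real.exp_pos 1).le hn⟩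

lemma criticalSlope_bounds : 0.847264 < criticalSlope ∧ criticalSlope < 0.847265 := by
  have h := exp_nat_lt 2 (by norm_num)
  rw [criticalSlope]
  norm_num at h ⊢
  constructor <;> linarith [h.1, h.2]

/-- Taking suitable powers reduces the bounds to rational estimates of `exp 1` and `exp 4`. -/
lemma log_criticalSlope_bounds :
    -(1 / 6) ≤ Real.log criticalSlope ∧ Real.log criticalSlope ≤ -0.16 := by
  obtain ⟨h1, h2⟩ := criticalSlope_bounds
  have h0 : 0 < criticalSlope := by linarith
  constructor
  · have h3 : Real.log (criticalSlope ^ 6) = 6 * Real.log criticalSlope := by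
      rw [Real.log_pow]; norm_num
    have h4 : -1 ≤ Real.log (criticalSlope ^ 6) := by
      rw [Real.le_log_iff_exp_le (by positivity), Real.exp_neg, inv_le_comm₀ (Real.exp_pos 1)
        (by positivity)]
      have h5 : (0.847264 : ℝ) ^ 6 ≤ criticalSlope ^ 6 := by gcongr
      have h6 : (criticalSlope ^ 6)⁻¹ ≤ ((0.847264 : ℝ) ^ 6)⁻¹ := by gcongr
      refine h6.trans (le_trans ?_ Real.exp_one_gt_d9.le)
      norm_num
    linarith
  · have h3 : Real.log (criticalSlope ^ 25) = 25 * Real.log criticalSlope := by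
      rw [Real.log_pow]; norm_num
    have h4 : Real.log (criticalSlope ^ 25) ≤ -4 := by
      rw [Real.log_le_iff_le_exp (by positivity), Real.exp_neg, le_inv_comm₀ (by positivity)
        (Real.exp_pos _)]
      have h5 : criticalSlope ^ 25 ≤ (0.847265 : ℝ) ^ 25 := by gcongr
      have h6 : ((0.847265 : ℝ) ^ 25)⁻¹ ≤ (criticalSlope ^ 25)⁻¹ := by gcongr
      refine le_trans ?_ h6
      have := (exp_nat_lt 4 (by norm_num)).2.le
      norm_num at this ⊢
      linarith
    linarith

lemma log_one_add_criticalSlope : Real.log (1 + criticalSlope) = 2 - 2 * Real.log 2 := by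
  rw [criticalSlope, add_sub_cancel, Real.log_div (Real.exp_pos _).ne' (by norm_num), Real.log_exp,
    show (4 : ℝ) = 2 ^ 2 by norm_num, Real.log_pow]
  norm_num

lemma log_base_bounds : 5.25 ≤ Real.log 190.9 ∧ Real.log 190.9 ≤ 5.2632 := by
  constructor
  · have h3 : Real.log (190.9 ^ 4) = 4 * Real.log 190.9 := by rw [Real.log_pow]; norm_num
    have h4 : 21 ≤ Real.log (190.9 ^ 4) := by
      rw [Real.le_log_iff_exp_le (by positivity)]
      have := (exp_nat_lt 21 (by norm_num)).2.le
      norm_num at this ⊢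
      linarith
    linarith
  · have h3 : Real.log (190.9 ^ 19) = 19 * Real.log 190.9 := by rw [Real.log_pow]; norm_num
    have h4 : Real.log (190.9 ^ 19) ≤ 100 := by
      rw [Real.log_le_iff_le_exp (by positivity)]
      have := (exp_nat_lt 100 (by norm_num)).1.le
      norm_num at this ⊢
      linarith
    linarith

/-- The numerical inequality behind the sign of the derivative of the Hutchings function. Here
`s = 2 w / π`; `E₁, E₂, E₃` come from the three round spheres and `y₁, y₂` from the two outer caps
of the double bubble. -/
theorem critical_inequality {s E₁ E₂ E₃ y₁ y₂ : ℝ} (hs : 190.9 ≤ s) (hy₁ : 0 < y₁) (hy₂ : 0 < y₂)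
    (hE₁ : criticalSlope * s / 2 + 2 * Real.log (criticalSlope * s / 2) - 1 ≤ E₁)
    (hE₂ : s + 2 * Real.log s - 1 ≤ E₂)
    (hE₃ : (1 + criticalSlope) * s + 2 * Real.log ((1 + criticalSlope) * s) - 1 ≤ E₃)
    (h₁ : y₁ - 2.15 - 2 * Real.log (y₁ / 2) ≤ criticalSlope * s)
    (h₂ : y₂ - 2.15 - 2 * Real.log (y₂ / 2) ≤ s) :
    criticalSlope / E₁ + 1 / E₂ + (1 + criticalSlope) / E₃ <
      2 * criticalSlope / y₁ + 2 / y₂ := by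
  obtain ⟨hc1, hc2⟩ := criticalSlope_bounds
  obtain ⟨hl1, hl2⟩ := log_criticalSlope_bounds
  obtain ⟨hb1, hb2⟩ := log_base_bounds
  have hlc := log_one_add_criticalSlope
  have h2a := Real.log_two_gt_d9
  have h2b := Real.log_two_lt_d9
  have hs0 : 0 < s := by linarith
  have hc0 : 0 < criticalSlope := by linarith
  set c := criticalSlope
  -- The logarithmic variable is normalized to vanish at the threshold; then `s ≥ 190.9 (1 + x)`
  -- turns powers of `1 / s` into decay in `x`.
  obtain ⟨x, hx⟩ : ∃ x, x = Real.log (s / 190.9) := ⟨_, rfl⟩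
  have hx0 : 0 ≤ x := by
    rw [hx]; exact Real.log_nonneg (by rw [le_div_iff₀ (by norm_num)]; linarith)
  have hls : Real.log s = x + Real.log 190.9 := by
    rw [hx, ← Real.log_mul (by positivity) (by norm_num)]; congr 1; field_simp
  have hsx : 190.9 * (1 + x) ≤ s := by
    have h3 := Real.log_le_sub_one_of_pos (div_pos hs0 (by norm_num : (0 : ℝ) < 190.9))
    rw [← hx] at h3
    have h4 : 190.9 * (s / 190.9) = s := by field_simp
    linarith
  rw [Real.log_div (by positivity) (by norm_num), Real.log_mul hc0.ne' hs0.ne', hls] at hE₁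
  rw [hls] at hE₂
  rw [Real.log_mul (by positivity) hs0.ne', hls, hlc] at hE₃
  have g1 := mul_le_of_log_le hy₁ (by positivity : 0 < c * s) h₁
  have g2 := mul_le_of_log_le hy₂ hs0 h₂
  rw [Real.log_div (by positivity) (by norm_num), Real.log_mul hc0.ne' hs0.ne', hls] at g1
  rw [Real.log_div (by positivity) (by norm_num), hls] at g2
  set σ := 1 / s with hσ
  have hσ0 : 0 < σ := by positivity
  have hsσ : s * σ = 1 := by rw [hσ]; field_simp
  have hσx : σ * (190.9 * (1 + x)) ≤ 1 :=
    (mul_le_mul_of_nonneg_left hsx hσ0.le).trans_eq (by rw [mul_comm, hsσ])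
  -- The constants `7.78`, `9.5`, `10.72` are lower bounds for `2 log (α * 190.9) - 1` with `α = c /
  -- 2`, `1`, `1 + c`.
  have e1 : s * (c / 2 + (2 * x + 7.78) * σ) ≤ E₁ := by
    have : s * (c / 2 + (2 * x + 7.78) * σ) = c * s / 2 + (2 * x + 7.78) * (s * σ) := by ring
    rw [this, hsσ]; linarith
  have e2 : s * (1 + (2 * x + 9.5) * σ) ≤ E₂ := by
    have : s * (1 + (2 * x + 9.5) * σ) = s + (2 * x + 9.5) * (s * σ) := by ring
    rw [this, hsσ]; linarith
  have e3 : s * ((1 + c) + (2 * x + 10.72) * σ) ≤ E₃ := by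
    have : s * ((1 + c) + (2 * x + 10.72) * σ) = (1 + c) * s + (2 * x + 10.72) * (s * σ) := by ring
    rw [this, hsσ]; linarith
  -- The coefficients come from dividing `2.15 + 2 log (c s / 2)` by `1 - 2 / (c s) ≥ 0.9876`; for
  -- `f2` the divisor is `0.98952`.
  have f1 : y₁ ≤ s * (c + (2.0252 * x + 11.11) * σ) := by
    have : s * (c + (2.0252 * x + 11.11) * σ) = c * s + (2.0252 * x + 11.11) * (s * σ) := by ring
    rw [this, hsσ, mul_one]
    have h3 : 2 / (c * s) ≤ 0.0124 := by rw [div_le_iff₀ (by positivity)]; nlinarith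
    by_contra! hcon
    have h4 : 0 < y₁ - c * s := by linarith
    have h5 : (y₁ - c * s) * 0.9876 ≤ (y₁ - c * s) * (1 - 2 / (c * s)) :=
      mul_le_mul_of_nonneg_left (by linarith) h4.le
    linarith
  have f2 : y₂ ≤ s * (1 + (2.0212 * x + 11.42) * σ) := by
    have : s * (1 + (2.0212 * x + 11.42) * σ) = s + (2.0212 * x + 11.42) * (s * σ) := by ring
    rw [this, hsσ, mul_one]
    have h3 : 2 / s ≤ 0.01048 := by rw [div_le_iff₀ (by positivity)]; linarith
    by_contra! hcon
    have h4 : 0 < y₂ - s := by linarith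
    have h5 : (y₂ - s) * 0.98952 ≤ (y₂ - s) * (1 - 2 / s) :=
      mul_le_mul_of_nonneg_left (by linarith) h4.le
    linarith
  exact sum_div_lt_of_expansion hc1 hc2 hs0 hsσ hy₁ hy₂ (by positivity) (by positivity)
    (by positivity) (by positivity) (by positivity) (by linarith) (by nlinarith) e1 e2 e3 f1 f2
    (critical_polynomial hx0 hσ0 hσx)

lemma lowerVolume_bounds {p : ℝ × ℝ} (hp : p ∈ pressureDomain) (h1 : p.1 ≤ 2 + 1 / 39)
    (h2 : p.2 ≤ 2 + 1 / 39) :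
    4 / (p.2 - 2) - 2.15 - 2 * Real.log (4 / (p.2 - 2) / 2) ≤ 2 / Real.pi * lowerVolume p ∧
      2 / Real.pi * lowerVolume p < 4 / (p.2 - 2) := by
  rw [← upperVolume_swap]
  exact upperVolume_bounds (p := p.swap) ⟨hp.2, hp.1⟩ h2 h1

/-- Existence of large double bubbles of volume ratio `criticalSlope`. -/
lemma exists_bubble {t : ℝ} (ht : 295 < t) : ∃ p ∈ pressureDomain,
    p.1 ≤ 2 + 1 / 39 ∧ p.2 ≤ 2 + 1 / 39 ∧ upperVolume p = criticalSlope * t ∧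
      lowerVolume p = t := by
  obtain ⟨hc1, hc2⟩ := criticalSlope_bounds
  have hpi := Real.pi_gt_three
  have hpi' := Real.pi_lt_d4
  -- At the lower edge, where `4 / (p - 2) = 2 t + 100`, the chamber is larger than `t`, hence
  -- larger than both targets. The tangent of the logarithm at `Z = 16` keeps the loss a small
  -- multiple of `Z`.
  have hlo : ∀ Z v : ℝ, Z = 2 * t + 100 → Z - 2.15 - 2 * Real.log (Z / 2) ≤ 2 / Real.pi * v →
      t < v := by
    intro Z v hZ h
    have h1 : Real.log (Z / 2) = Real.log (Z / 16) + 3 * Real.log 2 := by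
      rw [show Z / 2 = Z / 16 * 2 ^ 3 by ring, Real.log_mul
        (by linarith : (0 : ℝ) < Z / 16).ne' (by norm_num), Real.log_pow]
      norm_num
    have h2 := Real.log_le_sub_one_of_pos (show 0 < Z / 16 by linarith)
    have h3 := Real.log_two_lt_d9
    have h4 : t < 2 / Real.pi * v := by linarith
    have h5 : 2 / Real.pi * v * Real.pi = 2 * v := by field_simp
    nlinarith
  -- At the upper edge `2 + 1 / 39` the volume is below `78 π < 245.1`, while `criticalSlope * t >
  -- 249` for `t > 295`.
  have hhi : ∀ v : ℝ, 2 / Real.pi * v < 156 → v < criticalSlope * t := by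
    intro v h
    have h5 : 2 / Real.pi * v * Real.pi = 2 * v := by field_simp
    nlinarith
  have hct : criticalSlope * t < t := by nlinarith
  have hY : 4 / (2 + 4 / (2 * t + 100) - 2) = 2 * t + 100 := by
    rw [add_sub_cancel_left]; field_simp
  have hY0 : 0 < 4 / (2 * t + 100) := by positivity
  have hlh : 2 + 4 / (2 * t + 100) < 2 + 1 / 39 := by
    have : 4 / (2 * t + 100) < 1 / 39 := by
      rw [div_lt_div_iff₀ (by linarith) (by norm_num)]; linarith
    linarith
  obtain ⟨p, hp1, hp2, hv, hw⟩ := exists_bubble_of_box (v := criticalSlope * t) (w := t)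
    (lo := 2 + 4 / (2 * t + 100)) (hi := 2 + 1 / 39) (by linarith) hlh
    (fun y hy => hct.trans (hlo _ _ hY (upperVolume_bounds (p := (_, y))
      ⟨by simp only; linarith, by simp only; linarith [hy.1]⟩ hlh.le hy.2).1))
    (fun y hy => hhi _ (by
      have := (upperVolume_bounds (p := (2 + 1 / 39, y))
        ⟨by norm_num, by simp only; linarith [hy.1]⟩ le_rfl hy.2).2
      norm_num at this ⊢
      exact this))
    (fun x hx => hlo _ _ hY (lowerVolume_bounds (p := (x, _))
      ⟨by simp only; linarith [hx.1], by simp only; linarith⟩ hx.2 hlh.le).1)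
    (fun x hx => (hhi _ (by
      have := (lowerVolume_bounds (p := (x, 2 + 1 / 39))
        ⟨by simp only; linarith [hx.1], by norm_num⟩ hx.2 le_rfl).2
      norm_num at this ⊢
      exact this)).trans hct)
  exact ⟨p, ⟨by linarith [hp1.1], by linarith [hp2.1]⟩, hp1.2, hp2.2, hv, hw⟩

lemma hasDerivAt_sphereArea_mul {c t y : ℝ} (hy : 1 < y) (h : ballVolume y = c * t) :
    HasDerivAt (fun t => sphereArea (c * t)) (2 * (y ^ 2 + 1) / (y ^ 2 - 1) * c) t :=
  HasDerivAt.comp (h₂ := sphereArea) t (by rw [← h]; exact hasDerivAt_sphereArea hy)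
    (by simpa using (hasDerivAt_id t).const_mul c)

end HypBubble

open HypBubble in
theorem proposition4p23 (w : ℝ) (hw : 300 ≤ w) :
    HypBubble.HutchingsWellDefined (HypBubble.criticalSlope * w) w ∧
      ∃ F' : ℝ,
        HasDerivAt (fun t : ℝ => HypBubble.hutchings (HypBubble.criticalSlope * t) t) F' w ∧
          F' < 0 := by
  obtain ⟨hc1, hc2⟩ := criticalSlope_bounds
  have hc0 : 0 < criticalSlope := by linarith
  have hw0 : 0 < w := by linarith
  have hpi := Real.pi_pos
  obtain ⟨p, hp, hp1, hp2, hV, hW⟩ := exists_bubble (show 295 < w by linarith)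
  constructor
  · refine ⟨existsUnique_isSphereArea (by positivity), existsUnique_isSphereArea hw0,
      existsUnique_isSphereArea (by positivity), bubbleArea p, ?_, fun a ha => ?_⟩
    · have := (isDoubleBubbleArea_iff_eq hp (by rw [hV]; positivity) (by rwa [hW])).2
        (rfl : bubbleArea p = bubbleArea p)
      rwa [hV, hW] at this
    · rw [← hV, ← hW] at ha
      exact (isDoubleBubbleArea_iff_eq hp (by rw [hV]; positivity) (by rwa [hW])).1
        (by rwa [hW] at ha ⊢)
  obtain ⟨z₁, hz₁, hv₁⟩ := exists_ballVolume_eq (show 0 < criticalSlope / 2 * w by positivity)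
  -- The factor `1` gives this term the same shape `c * t` as the other two.
  obtain ⟨z₂, hz₂, hv₂⟩ := exists_ballVolume_eq (show 0 < 1 * w by positivity)
  obtain ⟨z₃, hz₃, hv₃⟩ := exists_ballVolume_eq (show 0 < (1 + criticalSlope) * w by positivity)
  have d₁ := hasDerivAt_sphereArea_mul hz₁ hv₁
  have d₂ := hasDerivAt_sphereArea_mul hz₂ hv₂
  have d₃ := hasDerivAt_sphereArea_mul hz₃ hv₃
  have d := (((d₁.const_mul 2).add d₂).add d₃).sub
    ((hasDerivAt_doubleBubbleArea hp hc0 hw0 hV hW).const_mul 2)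
  refine ⟨_, d.congr_of_eventuallyEq (Filter.Eventually.of_forall fun t => ?_), ?_⟩
  · simp only [hutchings, Pi.add_apply, Pi.sub_apply]
    ring_nf
  -- The threshold is `600 / π ≈ 190.99`, rounded down.
  · have hs : 190.9 ≤ 2 / Real.pi * w := by
      have := Real.pi_lt_d4
      rw [div_mul_eq_mul_div, le_div_iff₀ hpi]
      nlinarith
    have hδ₁ : 0 < p.1 - 2 := by linarith [hp.1]
    have hδ₂ : 0 < p.2 - 2 := by linarith [hp.2]
    have hE₁ := le_sq_sub_one_of_ballVolume hz₁ (a := criticalSlope * (2 / Real.pi * w) / 2)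
      (by nlinarith) (by rw [hv₁]; ring)
    have hE₂ := le_sq_sub_one_of_ballVolume hz₂ (a := 2 / Real.pi * w) (by linarith)
      (by rw [hv₂]; ring)
    have hE₃ := le_sq_sub_one_of_ballVolume hz₃ (a := (1 + criticalSlope) * (2 / Real.pi * w))
      (by nlinarith) (by rw [hv₃]; ring)
    have h₁ := (upperVolume_bounds hp hp1 hp2).1
    have h₂ := (lowerVolume_bounds hp hp1 hp2).1
    rw [hV, show 2 / Real.pi * (criticalSlope * w) = criticalSlope * (2 / Real.pi * w) by ring]
      at h₁
    rw [hW] at h₂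
    have key := critical_inequality hs (div_pos four_pos hδ₁) (div_pos four_pos hδ₂)
      hE₁ hE₂ hE₃ h₁ h₂
    have q₁ : 2 * (z₁ ^ 2 + 1) / (z₁ ^ 2 - 1) = 2 + 4 * (1 / (z₁ ^ 2 - 1)) := by
      have : z₁ ^ 2 - 1 ≠ 0 := by nlinarith
      field_simp; ring
    have q₂ : 2 * (z₂ ^ 2 + 1) / (z₂ ^ 2 - 1) = 2 + 4 * (1 / (z₂ ^ 2 - 1)) := by
      have : z₂ ^ 2 - 1 ≠ 0 := by nlinarith
      field_simp; ring
    have q₃ : 2 * (z₃ ^ 2 + 1) / (z₃ ^ 2 - 1) = 2 + 4 * (1 / (z₃ ^ 2 - 1)) := by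
      have : z₃ ^ 2 - 1 ≠ 0 := by nlinarith
      field_simp; ring
    have r₁ : 2 * criticalSlope / (4 / (p.1 - 2)) = criticalSlope * (p.1 - 2) / 2 := by
      field_simp; ring
    have r₂ : 2 / (4 / (p.2 - 2)) = (p.2 - 2) / 2 := by field_simp; ring
    rw [r₁, r₂, div_eq_mul_one_div criticalSlope, div_eq_mul_one_div (1 + criticalSlope)] at key
    rw [q₁, q₂, q₃]
    -- The constant parts `2` of the pressures contribute `2c + 2 + 2(1 + c) - 4c - 4 = 0`, so only
    -- four times the critical inequality remains.
    linear_combination 4 * key
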